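/- **Setting.** Let $d\ge 1$. For a distribution $G$ of a pair $(X,Y)$ with values in $[0,1]^d\times\{0,1\}$ let $G_X$ be the marginal law of $X$, let $\eta_G(x)=G(Y=1\mid X=x)$ for $x\in\mathrm{supp}(G_X)$ and $\eta_G(x)=\tfrac12$ otherwise, and let $f^*_G(x)=\mathbf 1\{\eta_G(x)>\tfrac12\}$. For $f:\mathbb R^d\to\{0,1\}$ let $R_G(f)=G(Y\ne f(X))$ and $\mathcal E_G(f)=R_G(f)-R_G(f^*_G)$. Conditional probabilities and densities are determined up to null sets only, and pointwise conditions on them are meant accordingly; $\lambda$ is Lebesgue measure and $B(x,r)$ the closed Euclidean ball. Let $\alpha\ge0$, $0<\beta\le1$, $\gamma>0$, $C_\alpha,C_\beta,C_\gamma,c_\mu,r_\mu>0$ and $\mu=(\mu_-,\mu_+)$ with $0<\mu_-<\mu_+$ and $\mu_+>1$. Let $\Pi=\Pi(\alpha,C_\alpha,\beta,C_\beta,\gamma,C_\gamma,\mu,c_\mu,r_\mu)$ be the set of pairs $(P,Q)$ of distributions on $[0,1]^d\times\{0,1\}$ such that * for all $x\in \mathrm{supp}(P_X)\cup\mathrm{supp}(Q_X)$: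 $(\eta_P(x)-\frac12)(\eta_Q(x)-\frac12)\ge0$ and $|\eta_P(x)-\frac12|\ge C_\gamma|\eta_Q(x)-\frac12|^\gamma$; * $Q_X(0<|\eta_Q(X)-\frac12|<t)\le C_\alpha t^\alpha$ for all $t>0$; * $\eta_Q$ coincides on $\mathrm{supp}(Q_X)$ with a function $g:\mathbb R^d\to\mathbb R$ satisfying $|g(x)-g(y)|\le C_\beta\|x-y\|^\beta$ for all $x,y\in\mathbb R^d$; * $P_X,Q_X$ are absolutely continuous with respect to $\lambda$ with a common support $\Omega$; $\lambda(\Omega\cap B(x,r))\ge c_\mu\lambda(B(x,r))$ for all $x\in\Omega$ and $0<r\le r_\mu$; and the densities of $P_X$ and $Q_X$ lie strictly between $\mu_-$ and $\mu_+$ on $\Omega$. The data consist of $n_P$ observations from $P$ and $n_Q$ observations from $Q$, all independent. A classifier $\hat f$ is a (jointly measurable) rule that assigns to the data a function $\mathbb R^d\to\{0,1\}$. **Theorem (lower bound).** Suppose that $c_\mu\le c_0$, where $c_0>0$ is a certain constant that depends only on $d,\mu,r_\mu$, and that either $\alpha\beta<d$, or $\alpha\beta=d$ and $C_\alpha\ge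 A_0$, where $A_0$ is a certain constant that depends only on $d,\mu,r_\mu,\alpha,C_\beta$. Then there is a constant $c>0$, not depending on $n_P$ or $n_Q$, such that for all $n_P,n_Q\ge0$ with $n_P+n_Q\ge1$ $$\inf_{\hat f}\ \sup_{(P,Q)\in\Pi}\ \mathbb E\,\mathcal E_Q(\hat f)\ \ge\ c\left(n_P^{\frac{2\beta+d}{2\gamma\beta+d}}+n_Q\right)^{-\frac{\beta(1+\alpha)}{2\beta+d}} .$$ -/

import Mathlib

open MeasureTheory ProbabilityTheory

noncomputable section

namespace PosteriorDrift

/-- The covariate space: `ℝ^d` with the Euclidean norm and Lebesgue measure `volume`. -/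
abbrev Cov (d : ℕ) : Type := EuclideanSpace ℝ (Fin d)

/-- A labelled observation `(X, Y)` with `X ∈ ℝ^d` and `Y ∈ {0, 1}`. -/
abbrev Obs (d : ℕ) : Type := Cov d × Fin 2

/-- The cube `[0,1]^d`. -/
def unitCube (d : ℕ) : Set (Cov d) := {x | ∀ i, x i ∈ Set.Icc (0 : ℝ) 1}

/-- The marginal distribution `G_X` of the covariate under a distribution `G` of `(X, Y)`. -/
def marginal {d : ℕ} (G : ProbabilityMeasure (Obs d)) : Measure (Cov d) :=
  (G : Measure (Obs d)).fst

open Classical in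
/-- The regression function `η_G(x) = G(Y = 1 | X = x)` for `x` in the support of `G_X`, and `1/2`
elsewhere. The conditional distribution of `Y` given `X` is the disintegration
`Measure.condKernel`; it is determined up to a `G_X`-null set only, so every condition on `η_G`
below is imposed `G_X`-almost everywhere. -/
def eta {d : ℕ} (G : ProbabilityMeasure (Obs d)) (x : Cov d) : ℝ :=
  if x ∈ (marginal G).support then ((G : Measure (Obs d)).condKernel x).real {1} else 1 / 2

open Classical in
/-- The Bayes classifier `f*_G`: label `0` if `η_G(x) ≤ 1/2`, label `1` otherwise. -/
def bayes {d : ℕ} (G : ProbabilityMeasure (Obs d)) (x : Cov d) : Fin 2 :=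
  if eta G x ≤ 1 / 2 then 0 else 1

/-- The misclassification risk `R_G(f) = G(Y ≠ f(X))`. -/
def risk {d : ℕ} (G : ProbabilityMeasure (Obs d)) (f : Cov d → Fin 2) : ℝ :=
  (G : Measure (Obs d)).real {z | z.2 ≠ f z.1}

/-- The excess risk `R_G(f) - R_G(f*_G)`. -/
def excessRisk {d : ℕ} (G : ProbabilityMeasure (Obs d)) (f : Cov d → Fin 2) : ℝ :=
  risk G f - risk G (bayes G)

/-- The class `Γ(γ, C_γ)` of pairs with relative signal exponent `γ`. -/
def RelativeSignalExponent {d : ℕ} (γ Cγ : ℝ) (P Q : ProbabilityMeasure (Obs d)) : Prop :=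
  ∀ᵐ x ∂(marginal P + marginal Q),
    0 ≤ (eta P x - 1 / 2) * (eta Q x - 1 / 2) ∧
      Cγ * |eta Q x - 1 / 2| ^ γ ≤ |eta P x - 1 / 2|

/-- The Hölder class `H(β, C_β)` of functions on `ℝ^d`. -/
def HolderClass (d : ℕ) (β Cβ : ℝ) : Set (Cov d → ℝ) :=
  {g | ∀ x y, |g x - g y| ≤ Cβ * ‖x - y‖ ^ β}

/-- The margin class `M(α, C_α)`: `Q_X(0 < |η_Q(X) - 1/2| < t) ≤ C_α t^α` for all `t > 0`. -/
def MarginClass {d : ℕ} (α Cα : ℝ) (Q : ProbabilityMeasure (Obs d)) : Prop :=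
  ∀ t : ℝ, 0 < t →
    (marginal Q).real {x | 0 < |eta Q x - 1 / 2| ∧ |eta Q x - 1 / 2| < t} ≤ Cα * t ^ α

/-- `S(μ, c_μ, r_μ)`: common support and strong density, `μ = (μ₁, μ₂)` being the lower and the
upper bound for the two marginal densities on the common support. -/
structure StrongDensity {d : ℕ} (μ₁ μ₂ cμ rμ : ℝ) (P Q : ProbabilityMeasure (Obs d)) : Prop where
  ac_source : marginal P ≪ volume
  ac_target : marginal Q ≪ volume
  common_support : (marginal P).support = (marginal Q).support
  regular : ∀ x ∈ (marginal Q).support, ∀ r : ℝ, 0 < r → r ≤ rμ →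
    ENNReal.ofReal cμ * volume (Metric.closedBall x r) ≤
      volume ((marginal Q).support ∩ Metric.closedBall x r)
  density_source : ∀ᵐ x ∂(volume.restrict (marginal Q).support),
    ENNReal.ofReal μ₁ < (marginal P).rnDeriv volume x ∧
      (marginal P).rnDeriv volume x < ENNReal.ofReal μ₂
  density_target : ∀ᵐ x ∂(volume.restrict (marginal Q).support),
    ENNReal.ofReal μ₁ < (marginal Q).rnDeriv volume x ∧
      (marginal Q).rnDeriv volume x < ENNReal.ofReal μ₂

/-- The posterior drift parameter space `Π(α, C_α, β, C_β, γ, C_γ, μ, c_μ, r_μ)` of pairs `(P, Q)`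
of distributions on `[0,1]^d × {0,1}`. Smoothness says that the regression function of `Q`
coincides on the support of `Q_X` with a member of `H(β, C_β)`; its conventional value `1/2` off
the support carries no smoothness requirement. -/
structure ParamSpace {d : ℕ} (α Cα β Cβ γ Cγ μ₁ μ₂ cμ rμ : ℝ)
    (P Q : ProbabilityMeasure (Obs d)) : Prop where
  cube_source : ∀ᵐ x ∂(marginal P), x ∈ unitCube d
  cube_target : ∀ᵐ x ∂(marginal Q), x ∈ unitCube d
  signal : RelativeSignalExponent γ Cγ P Q
  margin : MarginClass α Cα Q
  smooth : ∃ g ∈ HolderClass d β Cβ, ∀ᵐ x ∂(marginal Q), eta Q x = g x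
  density : StrongDensity μ₁ μ₂ cμ rμ P Q

/-- The data: `nP` source observations and `nQ` target observations. -/
abbrev Sample (d nP nQ : ℕ) : Type := (Fin nP → Obs d) × (Fin nQ → Obs d)

/-- The law of the data: all observations are independent, the source ones with law `P`, the
target ones with law `Q`. -/
def sampleLaw {d : ℕ} (nP nQ : ℕ) (P Q : ProbabilityMeasure (Obs d)) :
    Measure (Sample d nP nQ) :=
  (Measure.pi fun _ : Fin nP => (P : Measure (Obs d))).prod
    (Measure.pi fun _ : Fin nQ => (Q : Measure (Obs d)))

/-- Data-dependent classifiers `f̂`: maps sending the data and a point `x` to a label, jointly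
measurable. -/
abbrev Classifier (d nP nQ : ℕ) : Type :=
  {f : Sample d nP nQ → Cov d → Fin 2 // Measurable fun p : Sample d nP nQ × Cov d => f p.1 p.2}

/-- The expected excess risk `E_Z [R_Q(f̂) - R_Q(f*_Q)]`. The excess risk is nonnegative, so the
expectation is a `[0,∞]`-valued integral. -/
def expectedExcessRisk {d nP nQ : ℕ} (P Q : ProbabilityMeasure (Obs d))
    (f : Classifier d nP nQ) : ENNReal :=
  ∫⁻ z, ENNReal.ofReal (excessRisk Q (f.1 z)) ∂(sampleLaw nP nQ P Q)

/-- The minimax risk `inf_{f̂} sup_{(P,Q) ∈ Π} E_Z [R_Q(f̂) - R_Q(f*_Q)]`. -/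
def minimaxRisk (d nP nQ : ℕ) (α Cα β Cβ γ Cγ μ₁ μ₂ cμ rμ : ℝ) : ENNReal :=
  ⨅ f : Classifier d nP nQ,
    ⨆ (P : ProbabilityMeasure (Obs d)) (Q : ProbabilityMeasure (Obs d))
      (_ : ParamSpace α Cα β Cβ γ Cγ μ₁ μ₂ cμ rμ P Q), expectedExcessRisk P Q f

end PosteriorDrift

end

open MeasureTheory ProbabilityTheory

noncomputable section

namespace PosteriorDrift

/-! ### The comb and the grid of cells -/

/-! The bound is Assouad's argument on a support with holes. For each `M` both covariate laws are
uniform on `M ^ d` cubes of side `a / M`, separated by gaps `(1 - a) / M`, with a fixed `a` in `(0,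
1)`. Their density is `a⁻ᵈ`, and `μ₂ > 1` is what allows a value above 1 strictly between the two
density bounds. The gaps replace the usual smooth bumps: `η_Q - 1/2` may be constant on each cell,
and all values of size at most `τ ≍ M ^ (-β)` extend to a Hölder function. Since cells and holes
shrink in proportion, the regularity constant of the support does not depend on `M`.

On a set `A` of `m` cells put `η_Q = 1/2 ± τ` and `η_P = 1/2 ± Cγ τ ^ γ` with the same sign, and let
both be `1/2` on the other cells. The margin condition becomes `m M⁻ᵈ ≤ Cα τ ^ α`. If `(n_P τ ^ (2γ)
+ n_Q τ²) M⁻ᵈ` is small, the data cannot detect the sign on a single cell, while the losses of any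
classifier on that cell under the two signs add up to `2 τ M⁻ᵈ`. Averaging over all sign vectors
gives a risk of order `m τ M⁻ᵈ`. Let `N` be the base of the power in the claimed rate. With `M ≍ N ^
(1 / (2β + d))` and `m ≍ M ^ (d - αβ)` the risk is of order `M ^ (-β(1 + α))`, which is the rate.
The condition `αβ ≤ d` leaves room for at least one cell; at equality `m` no longer grows with `M`,
and `Cα` has to be large enough for one cell.

The argument is carried by `grid_regular` (geometry), `exists_holder_extension` (smoothness),
`two_point_bound` (testing), `assouad_bound` (averaging), `paramSpace_labelled` (membership in the
class) and `rate_le_minimaxRisk` (choice of the mesh). -/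

/-- The union of the intervals `[j / M, (j + s) / M]` for `j < M`. -/
def comb (M : ℕ) (s : ℝ) : Set ℝ :=
  ⋃ j : Fin M, Set.Icc ((j : ℝ) / M) (((j : ℝ) + s) / M)

/-- The cell of the grid with multi-index `k`. -/
def cell {d M : ℕ} (s : ℝ) (k : Fin d → Fin M) : Set (Cov d) :=
  {x | ∀ i, x i ∈ Set.Icc ((k i : ℝ) / M) (((k i : ℝ) + s) / M)}

/-- The union of all cells: the `d`-th power of the comb. -/
def grid (d M : ℕ) (s : ℝ) : Set (Cov d) := {x | ∀ i, x i ∈ comb M s}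

lemma volume_box {d : ℕ} (S : Fin d → Set ℝ) (hS : ∀ i, MeasurableSet (S i)) :
    volume {x : Cov d | ∀ i, x i ∈ S i} = ∏ i, volume (S i) := by
  have h := (PiLp.volume_preserving_ofLp (Fin d)).measure_preimage
    (MeasurableSet.univ_pi hS).nullMeasurableSet
  rw [volume_pi_pi] at h
  rw [← h]
  congr 1
  ext x
  simp

lemma measurableSet_comb (M : ℕ) (s : ℝ) : MeasurableSet (comb M s) :=
  MeasurableSet.iUnion fun _ => measurableSet_Icc

lemma isClosed_comb (M : ℕ) (s : ℝ) : IsClosed (comb M s) :=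
  isClosed_iUnion_of_finite fun _ => isClosed_Icc

lemma isClosed_grid (d M : ℕ) (s : ℝ) : IsClosed (grid d M s) := by
  have : grid d M s = ⋂ i : Fin d, (fun x : Cov d => x i) ⁻¹' comb M s := by
    ext x; simp [grid]
  rw [this]
  exact isClosed_iInter fun i => (isClosed_comb M s).preimage (by fun_prop)

lemma measurableSet_cell {d M : ℕ} (s : ℝ) (k : Fin d → Fin M) : MeasurableSet (cell s k) := by
  have : cell s k = ⋂ i : Fin d, (fun x : Cov d => x i) ⁻¹'
      Set.Icc ((k i : ℝ) / M) (((k i : ℝ) + s) / M) := by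
    ext x; simp [cell]
  rw [this]
  exact MeasurableSet.iInter fun i => measurableSet_Icc.preimage (by fun_prop)

lemma mem_grid_iff {d M : ℕ} {s : ℝ} {x : Cov d} :
    x ∈ grid d M s ↔ ∃ k : Fin d → Fin M, x ∈ cell s k := by
  simp only [grid, comb, Set.mem_ofPred_eq, Set.mem_iUnion, cell]
  exact Classical.skolem

lemma cell_subset_grid {d M : ℕ} (s : ℝ) (k : Fin d → Fin M) : cell s k ⊆ grid d M s :=
  fun _ hx => mem_grid_iff.2 ⟨k, hx⟩

lemma grid_subset_unitCube {d M : ℕ} {s : ℝ} (hs : s ≤ 1) : grid d M s ⊆ unitCube d := by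
  intro x hx i
  obtain ⟨j, hj⟩ := Set.mem_iUnion.1 (hx i)
  have hM : (0 : ℝ) < M := by exact_mod_cast j.pos
  have hj' : (j : ℝ) + 1 ≤ M := by exact_mod_cast j.isLt
  refine ⟨le_trans (by positivity) hj.1, hj.2.trans ?_⟩
  rw [div_le_one hM]
  linarith

/-- Points of distinct teeth of the comb are separated. -/
lemma tooth_gap {M : ℕ} {s : ℝ} {a b : ℕ} {x y : ℝ} (hab : a < b)
    (hx : x ≤ ((a : ℝ) + s) / M) (hy : (b : ℝ) / M ≤ y) : (1 - s) / M ≤ y - x := by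
  have hab' : (a : ℝ) + 1 ≤ b := by exact_mod_cast hab
  calc (1 - s) / M ≤ (b : ℝ) / M - ((a : ℝ) + s) / M := by
        rw [← sub_div]
        exact div_le_div_of_nonneg_right (by linarith) (Nat.cast_nonneg M)
    _ ≤ y - x := by linarith

/-- Points of distinct cells are separated. -/
lemma cell_gap {d M : ℕ} {s : ℝ} {k l : Fin d → Fin M} (hkl : k ≠ l) {x y : Cov d}
    (hx : x ∈ cell s k) (hy : y ∈ cell s l) : (1 - s) / M ≤ ‖x - y‖ := by
  obtain ⟨i, hi⟩ := Function.ne_iff.1 hkl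
  refine le_trans ?_ (PiLp.norm_apply_le (x - y) i)
  rw [PiLp.sub_apply, Real.norm_eq_abs]
  rcases lt_or_gt_of_ne hi with h | h
  · rw [abs_sub_comm]
    exact (tooth_gap (Fin.lt_def.1 h) (hx i).2 (hy i).1).trans (le_abs_self _)
  · exact (tooth_gap (Fin.lt_def.1 h) (hy i).2 (hx i).1).trans (le_abs_self _)

lemma cell_unique {d M : ℕ} {s : ℝ} (hs : s < 1) {k l : Fin d → Fin M} {x : Cov d}
    (hx : x ∈ cell s k) (hy : x ∈ cell s l) : k = l := by
  by_contra hkl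
  have h := cell_gap hkl hx hy
  rw [sub_self, norm_zero] at h
  obtain ⟨i, -⟩ := Function.ne_iff.1 hkl
  have hM : (0 : ℝ) < M := by exact_mod_cast (k i).pos
  have : 0 < (1 - s) / M := div_pos (by linarith) hM
  linarith

/-- The measure of `q` consecutive teeth. -/
lemma volume_teeth {M : ℕ} {s : ℝ} (hM : 0 < M) (hs : s < 1) (a q : ℕ) :
    volume (⋃ i ∈ Finset.range q,
      Set.Icc (((a + i : ℕ) : ℝ) / M) ((((a + i : ℕ) : ℝ) + s) / M)) =
      ENNReal.ofReal (q * (s / M)) := by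
  rw [measure_biUnion_finset]
  · have : ∀ i ∈ Finset.range q, volume (Set.Icc (((a + i : ℕ) : ℝ) / M)
        ((((a + i : ℕ) : ℝ) + s) / M)) = ENNReal.ofReal (s / M) := by
      intro i _
      rw [Real.volume_Icc]
      congr 1
      ring
    rw [Finset.sum_congr rfl this, Finset.sum_const, Finset.card_range, nsmul_eq_mul,
      ENNReal.ofReal_mul (by positivity), ENNReal.ofReal_natCast]
  · intro i _ j _ hij
    have hM' : (0 : ℝ) < M := by exact_mod_cast hM
    have hg : 0 < (1 - s) / M := div_pos (by linarith) hM'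
    refine Set.disjoint_left.2 fun x hx hy => ?_
    rcases lt_or_gt_of_ne hij with h | h
    · have := tooth_gap (show a + i < a + j by omega) hx.2 hy.1
      linarith
    · have := tooth_gap (show a + j < a + i by omega) hy.2 hx.1
      linarith
  · exact fun _ _ => measurableSet_Icc

lemma teeth_subset_comb {M : ℕ} {s : ℝ} {a q : ℕ} (h : a + q ≤ M) :
    (⋃ i ∈ Finset.range q,
      Set.Icc (((a + i : ℕ) : ℝ) / M) ((((a + i : ℕ) : ℝ) + s) / M)) ⊆ comb M s := by
  refine Set.iUnion₂_subset fun i hi => ?_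
  have : a + i < M := by have := Finset.mem_range.1 hi; omega
  exact Set.subset_iUnion (fun j : Fin M => Set.Icc ((j : ℝ) / M) (((j : ℝ) + s) / M)) ⟨a + i, this⟩

lemma volume_comb {M : ℕ} {s : ℝ} (hM : 0 < M) (hs : s < 1) :
    volume (comb M s) = ENNReal.ofReal s := by
  have h : comb M s = ⋃ i ∈ Finset.range M,
      Set.Icc (((0 + i : ℕ) : ℝ) / M) ((((0 + i : ℕ) : ℝ) + s) / M) := by
    refine subset_antisymm (Set.iUnion_subset fun j => ?_) (teeth_subset_comb (by omega))
    intro x hx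
    refine Set.mem_iUnion₂.2 ⟨j, Finset.mem_range.2 j.isLt, ?_⟩
    simpa using hx
  rw [h, volume_teeth hM hs]
  congr 1
  have : (M : ℝ) ≠ 0 := by exact_mod_cast hM.ne'
  field_simp

/-- The comb is regular at all scales up to one, uniformly in `M`. -/
lemma comb_regular {M : ℕ} {s : ℝ} (hs0 : 0 < s) (hs : s < 1) {x ρ : ℝ} (hx : x ∈ comb M s)
    (hρ0 : 0 < ρ) (hρ : ρ ≤ 1) :
    ENNReal.ofReal (s * ρ / 4) ≤ volume (comb M s ∩ Set.Icc (x - ρ) (x + ρ)) := by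
  obtain ⟨j, hj⟩ := Set.mem_iUnion.1 hx
  have hM : 0 < M := j.pos
  have hM' : (0 : ℝ) < M := by exact_mod_cast hM
  -- A window that is short compared with the mesh is handled by the tooth containing `x` alone: it
  -- meets the window in length at least `min (s / M) ρ`. A long window contains many whole teeth.
  rcases le_total (M * ρ) 4 with h4 | h4
  · set l : ℝ := (j : ℝ) / M with hl
    have hr : ((j : ℝ) + s) / M = l + s / M := by rw [add_div]
    rw [hr] at hj
    obtain ⟨hj1, hj2⟩ := hj
    have hsub : Set.Icc (max l (x - ρ)) (min (l + s / M) (x + ρ)) ⊆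
        comb M s ∩ Set.Icc (x - ρ) (x + ρ) := by
      intro y hy
      refine ⟨Set.mem_iUnion.2 ⟨j, ?_, ?_⟩, ?_, ?_⟩
      · exact (le_max_left _ _).trans hy.1
      · rw [hr]; exact hy.2.trans (min_le_left _ _)
      · exact (le_max_right _ _).trans hy.1
      · exact hy.2.trans (min_le_right _ _)
    refine le_trans ?_ (measure_mono hsub)
    rw [Real.volume_Icc]
    refine ENNReal.ofReal_le_ofReal ?_
    have h1 : s * ρ / 4 ≤ s / M := by
      rw [le_div_iff₀ hM']
      nlinarith
    have h2 : s * ρ / 4 ≤ ρ := by nlinarith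
    rcases max_cases l (x - ρ) with ⟨e, _⟩ | ⟨e, _⟩ <;>
      rcases min_cases (l + s / M) (x + ρ) with ⟨e', _⟩ | ⟨e', _⟩ <;> rw [e, e'] <;> linarith
  · set q : ℕ := ⌊M * ρ / 2⌋₊ with hq
    have hq1 : (q : ℝ) ≤ M * ρ / 2 := Nat.floor_le (by positivity)
    have hq2 : M * ρ / 4 ≤ q := by
      have := Nat.lt_floor_add_one (M * ρ / 2)
      rw [← hq] at this
      linarith
    have hMρ : M * ρ ≤ M := by nlinarith
    have hjM : (j : ℝ) + 1 ≤ M := by exact_mod_cast j.isLt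
    -- A run of `q` whole teeth inside the window: it starts at tooth `j` if `j` lies in the left
    -- half of `[0, 1]`, and ends just before tooth `j` otherwise. Since `ρ ≤ 1`, `q` is at most `M
    -- / 2`, so the run fits on that side. The window reaches `ρ` to each side, the run only about
    -- `ρ / 2`, which absorbs the offset of `x` in its tooth.
    obtain ⟨a, ha1, ha2, ha3⟩ : ∃ a : ℕ, a + q ≤ M ∧ x - ρ ≤ (a : ℝ) / M ∧
        ((a : ℝ) + q) / M ≤ x + ρ := by
      have hx1 : (j : ℝ) ≤ x * M := (div_le_iff₀ hM').1 hj.1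
      have hx2 : x * M ≤ (j : ℝ) + s := (le_div_iff₀ hM').1 hj.2
      rcases le_total (2 * (j : ℝ)) M with h | h
      · refine ⟨j, ?_, ?_, ?_⟩
        · have : ((j : ℕ) : ℝ) + q ≤ M := by linarith
          exact_mod_cast this
        · rw [le_div_iff₀ hM']; nlinarith
        · rw [div_le_iff₀ hM']; nlinarith
      · have hqj : q ≤ (j : ℕ) := by
          have : (q : ℝ) ≤ (j : ℕ) := by linarith
          exact_mod_cast this
        refine ⟨j - q, by have := j.isLt; omega, ?_, ?_⟩
        · rw [le_div_iff₀ hM', Nat.cast_sub hqj]; nlinarith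
        · rw [div_le_iff₀ hM', Nat.cast_sub hqj]; nlinarith
    have hsub : (⋃ i ∈ Finset.range q,
        Set.Icc (((a + i : ℕ) : ℝ) / M) ((((a + i : ℕ) : ℝ) + s) / M)) ⊆
        comb M s ∩ Set.Icc (x - ρ) (x + ρ) := by
      refine Set.subset_inter (teeth_subset_comb ha1) (Set.iUnion₂_subset fun i hi => ?_)
      have hi' : (i : ℝ) + 1 ≤ q := by exact_mod_cast Finset.mem_range.1 hi
      refine Set.Icc_subset_Icc (ha2.trans ?_) (le_trans ?_ ha3)
      · gcongr; simp
      · push_cast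
        exact div_le_div_of_nonneg_right (by linarith) hM'.le
    refine le_trans ?_ (measure_mono hsub)
    rw [volume_teeth hM hs]
    refine ENNReal.ofReal_le_ofReal ?_
    calc s * ρ / 4 = M * ρ / 4 * (s / M) := by field_simp
      _ ≤ q * (s / M) := by gcongr

lemma volume_grid {d M : ℕ} {s : ℝ} (hM : 0 < M) (hs0 : 0 < s) (hs : s < 1) :
    volume (grid d M s) = ENNReal.ofReal (s ^ d) := by
  rw [grid, volume_box _ fun _ => measurableSet_comb M s]
  simp [volume_comb hM hs, ENNReal.ofReal_pow hs0.le]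

lemma volume_cell {d M : ℕ} {s : ℝ} (hs0 : 0 < s) (k : Fin d → Fin M) :
    volume (cell s k) = ENNReal.ofReal ((s / M) ^ d) := by
  rw [cell, volume_box _ fun _ => measurableSet_Icc]
  simp [← sub_div, ENNReal.ofReal_pow (show 0 ≤ s / M by positivity)]

/-- The constant of regularity of the grid at scales up to `R`. -/
def gridRegularity (d : ℕ) (s R : ℝ) : ℝ :=
  (s / (4 * (R * √d))) ^ d / (volume (Metric.closedBall (0 : Cov d) 1)).toReal

lemma gridRegularity_pos {d : ℕ} (hd : 0 < d) {s R : ℝ} (hs : 0 < s) (hR : 0 < R) :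
    0 < gridRegularity d s R := by
  have hd' : (0 : ℝ) < d := by exact_mod_cast hd
  have : 0 < (volume (Metric.closedBall (0 : Cov d) 1)).toReal :=
    ENNReal.toReal_pos (Metric.measure_closedBall_pos _ _ one_pos).ne'
      measure_closedBall_lt_top.ne
  unfold gridRegularity
  positivity

/-- The ball contains a cube of half-side `ρ = r / (R √d)`, on which the grid is a product of combs,
so `comb_regular` applies in each coordinate. Dividing by `R` as well keeps `ρ ≤ 1`, as
`comb_regular` requires, at the price of a constant that depends on `R`. -/
lemma grid_regular {d M : ℕ} (hd : 0 < d) {s R : ℝ} (hs0 : 0 < s) (hs : s < 1) (hR : 1 ≤ R)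
    {x : Cov d} (hx : x ∈ grid d M s) {r : ℝ} (hr0 : 0 < r) (hr : r ≤ R) :
    ENNReal.ofReal (gridRegularity d s R) * volume (Metric.closedBall x r) ≤
      volume (grid d M s ∩ Metric.closedBall x r) := by
  have hd1 : (1 : ℝ) ≤ d := by exact_mod_cast hd
  have hsd : 1 ≤ √(d : ℝ) := Real.one_le_sqrt.2 hd1
  set ρ : ℝ := r / (R * √d) with hρ
  have hRd : 0 < R * √d := by positivity
  have hρ0 : 0 < ρ := by positivity
  have hρ1 : ρ ≤ 1 := by
    rw [hρ, div_le_one hRd]; nlinarith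
  have hρr : √d * ρ ≤ r := by
    rw [hρ, mul_div_assoc', div_le_iff₀ hRd]
    have : √d * r ≤ (R * √d) * r := by gcongr; nlinarith
    linarith
  have hsub : {y : Cov d | ∀ i, y i ∈ comb M s ∩ Set.Icc (x i - ρ) (x i + ρ)} ⊆
      grid d M s ∩ Metric.closedBall x r := by
    intro y hy
    refine ⟨fun i => (hy i).1, ?_⟩
    rw [Metric.mem_closedBall, EuclideanSpace.dist_eq]
    refine le_trans (Real.sqrt_le_sqrt (?_ : _ ≤ (d : ℝ) * ρ ^ 2)) ?_
    · calc ∑ i, dist (y i) (x i) ^ 2 ≤ ∑ _i : Fin d, ρ ^ 2 := by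
            refine Finset.sum_le_sum fun i _ => ?_
            have : dist (y i) (x i) ≤ ρ := by
              rw [Real.dist_eq, abs_le]
              constructor <;> linarith [(hy i).2.1, (hy i).2.2]
            gcongr
        _ = (d : ℝ) * ρ ^ 2 := by simp
    · rw [Real.sqrt_mul (by positivity), Real.sqrt_sq hρ0.le]
      exact hρr
  refine le_trans ?_ (measure_mono hsub)
  rw [volume_box _ fun i => (measurableSet_comb M s).inter measurableSet_Icc]
  have hball : 0 < (volume (Metric.closedBall (0 : Cov d) 1)).toReal :=
    ENNReal.toReal_pos (Metric.measure_closedBall_pos _ _ one_pos).ne'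
      measure_closedBall_lt_top.ne
  calc ENNReal.ofReal (gridRegularity d s R) * volume (Metric.closedBall x r)
      = ENNReal.ofReal (gridRegularity d s R *
          (r ^ d * (volume (Metric.closedBall (0 : Cov d) 1)).toReal)) := by
        rw [Measure.addHaar_closedBall' volume x hr0.le, finrank_euclideanSpace_fin,
          ENNReal.ofReal_mul (gridRegularity_pos hd hs0 (by linarith)).le,
          ENNReal.ofReal_mul (by positivity), ENNReal.ofReal_toReal measure_closedBall_lt_top.ne]
    _ = ENNReal.ofReal ((s * ρ / 4) ^ d) := by
        congr 1
        have h : s * ρ / 4 = s / (4 * (R * √d)) * r := by rw [hρ]; field_simp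
        rw [h, mul_pow, gridRegularity]
        field_simp
    _ = ∏ _i : Fin d, ENNReal.ofReal (s * ρ / 4) := by
        simp [ENNReal.ofReal_pow (show 0 ≤ s * ρ / 4 by positivity)]
    _ ≤ _ := Finset.prod_le_prod' fun i _ => comb_regular hs0 hs (hx i) hρ0 hρ1

/-! ### Testing two product measures against each other -/

section Testing

variable {E : Type*}

/-- The product of a function `f` of the first observations and a function `g` of the second. -/
def sampleProd {m n : ℕ} (f g : E → ℝ) (z : (Fin m → E) × (Fin n → E)) : ℝ :=
  (∏ i, f (z.1 i)) * ∏ j, g (z.2 j)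

lemma sampleProd_mul {m n : ℕ} (f g f' g' : E → ℝ) (z : (Fin m → E) × (Fin n → E)) :
    sampleProd f g z * sampleProd f' g' z =
      sampleProd (fun x => f x * f' x) (fun x => g x * g' x) z := by
  simp only [sampleProd, Finset.prod_mul_distrib]
  ring

lemma sampleProd_nonneg {m n : ℕ} {f g : E → ℝ} (hf : ∀ x, 0 ≤ f x) (hg : ∀ x, 0 ≤ g x)
    (z : (Fin m → E) × (Fin n → E)) : 0 ≤ sampleProd f g z :=
  mul_nonneg (Finset.prod_nonneg fun _ _ => hf _) (Finset.prod_nonneg fun _ _ => hg _)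

variable [MeasurableSpace E]

lemma measurable_sampleProd {m n : ℕ} {f g : E → ℝ} (hf : Measurable f) (hg : Measurable g) :
    Measurable (sampleProd f g : (Fin m → E) × (Fin n → E) → ℝ) := by
  unfold sampleProd
  fun_prop

/-- It suffices to compare the measures of rectangles. The indicator of a rectangle times the
product density is a product of one-variable functions, whose integral factorizes. -/
lemma pi_withDensity_ofReal (n : ℕ) (ν : Measure E) [IsProbabilityMeasure ν] {f : E → ℝ}
    (hf0 : ∀ x, 0 ≤ f x) (hfi : Integrable f ν)
    [SigmaFinite (ν.withDensity fun x => ENNReal.ofReal (f x))] :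
    Measure.pi (fun _ : Fin n => ν.withDensity fun x => ENNReal.ofReal (f x)) =
      (Measure.pi fun _ : Fin n => ν).withDensity
        fun z => ENNReal.ofReal (∏ i, f (z i)) := by
  refine Measure.pi_eq fun S hS => ?_
  have hrect : ∀ z : Fin n → E, (Set.univ.pi S).indicator
      (fun z => ENNReal.ofReal (∏ i, f (z i))) z =
      ENNReal.ofReal (∏ i, (S i).indicator f (z i)) := by
    intro z
    by_cases hz : z ∈ Set.univ.pi S
    · rw [Set.indicator_of_mem hz]
      congr 1
      exact Finset.prod_congr rfl fun i _ =>
        (Set.indicator_of_mem (hz i (Set.mem_univ i)) f).symm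
    · rw [Set.indicator_of_notMem hz]
      obtain ⟨i, hi⟩ : ∃ i, z i ∉ S i := by
        by_contra! h
        exact hz fun i _ => h i
      rw [Finset.prod_eq_zero (Finset.mem_univ i) (Set.indicator_of_notMem hi f),
        ENNReal.ofReal_zero]
  have hint : ∀ i, Integrable ((S i).indicator f) ν := fun i => hfi.indicator (hS i)
  rw [withDensity_apply _ (MeasurableSet.univ_pi hS),
    ← lintegral_indicator (MeasurableSet.univ_pi hS), lintegral_congr hrect,
    ← ofReal_integral_eq_lintegral_ofReal (Integrable.fintype_prod hint)
      (ae_of_all _ fun z => Finset.prod_nonneg fun i _ =>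
        Set.indicator_nonneg (fun x _ => hf0 x) _),
    integral_fintype_prod_eq_prod, ENNReal.ofReal_prod_of_nonneg
      fun i _ => integral_nonneg fun x => Set.indicator_nonneg (fun x _ => hf0 x) _]
  refine Finset.prod_congr rfl fun i _ => ?_
  rw [withDensity_apply _ (hS i), ← lintegral_indicator (hS i),
    ofReal_integral_eq_lintegral_ofReal (hint i)
      (ae_of_all _ fun x => Set.indicator_nonneg (fun x _ => hf0 x) _)]
  refine lintegral_congr fun x => ?_
  by_cases hx : x ∈ S i <;> simp [hx]

variable {μ ν : Measure E} [IsProbabilityMeasure μ] [IsProbabilityMeasure ν]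

lemma integrable_sampleProd {m n : ℕ} {f g : E → ℝ} (hf : Integrable f μ) (hg : Integrable g ν) :
    Integrable (sampleProd f g)
      ((Measure.pi fun _ : Fin m => μ).prod (Measure.pi fun _ : Fin n => ν)) :=
  (Integrable.fintype_prod fun _ => hf).mul_prod (Integrable.fintype_prod fun _ => hg)

lemma integral_sampleProd (m n : ℕ) (f g : E → ℝ) :
    ∫ z, sampleProd f g z ∂((Measure.pi fun _ : Fin m => μ).prod
      (Measure.pi fun _ : Fin n => ν)) = (∫ x, f x ∂μ) ^ m * (∫ x, g x ∂ν) ^ n := by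
  unfold sampleProd
  rw [integral_prod_mul (fun z : Fin m → E => ∏ i, f (z i)) (fun z : Fin n → E => ∏ i, g (z i)),
    integral_fintype_prod_eq_pow, integral_fintype_prod_eq_pow, Fintype.card_fin, Fintype.card_fin]

/-- A real inequality behind the second moment bound for the likelihood ratios. -/
lemma moment_bound {m n : ℕ} {a b : ℝ} (ha0 : 0 ≤ a) (ha1 : a ≤ 1) (hb0 : 0 ≤ b) (hb1 : b ≤ 1)
    (h : m * a + n * b ≤ 1 / 5) :
    (1 + a) ^ m * (1 + b) ^ n - (1 - a) ^ m * (1 - b) ^ n ≤ 1 / 2 := by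
  have hup : (1 + a) ^ m * (1 + b) ^ n ≤ 5 / 4 := by
    calc (1 + a) ^ m * (1 + b) ^ n ≤ Real.exp a ^ m * Real.exp b ^ n := by
          gcongr
          · linarith [Real.add_one_le_exp a]
          · linarith [Real.add_one_le_exp b]
      _ = Real.exp (m * a + n * b) := by
          rw [← Real.exp_nat_mul, ← Real.exp_nat_mul, ← Real.exp_add]
      _ ≤ Real.exp (1 / 5) := Real.exp_le_exp.2 h
      _ ≤ 1 / (1 - 1 / 5) := Real.exp_bound_div_one_sub_of_interval (by norm_num) (by norm_num)
      _ = 5 / 4 := by norm_num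
  have hma : 0 ≤ m * a := by positivity
  have hnb : 0 ≤ n * b := by positivity
  -- Bernoulli's inequality in each factor. With the upper bound `5 / 4` the difference is at most
  -- `9 / 20`.
  have hlow : 4 / 5 ≤ (1 - a) ^ m * (1 - b) ^ n := by
    have h1 := one_add_mul_le_pow (show -2 ≤ -a by linarith) m
    have h2 := one_add_mul_le_pow (show -2 ≤ -b by linarith) n
    rw [mul_neg, ← sub_eq_add_neg, ← sub_eq_add_neg] at h1 h2
    calc (4 / 5 : ℝ) ≤ (1 - m * a) * (1 - n * b) := by nlinarith
      _ ≤ (1 - a) ^ m * (1 - b) ^ n :=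
        mul_le_mul h1 h2 (by linarith) (pow_nonneg (by linarith) _)
  linarith

lemma integrable_of_abs_le_one {u : E → ℝ} (hu : Measurable u) (hu1 : ∀ x, |u x| ≤ 1) :
    Integrable u μ :=
  Integrable.of_bound hu.aestronglyMeasurable 1 (ae_of_all _ hu1)

lemma integrable_sq_of_abs_le_one {u : E → ℝ} (hu : Measurable u) (hu1 : ∀ x, |u x| ≤ 1) :
    Integrable (fun x => u x ^ 2) μ := by
  refine Integrable.of_bound (hu.pow_const 2).aestronglyMeasurable 1 (ae_of_all _ fun x => ?_)
  rw [Real.norm_eq_abs, abs_pow]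
  exact pow_le_one₀ (abs_nonneg _) (hu1 x)

lemma integral_one_add {u : E → ℝ} (hu : Measurable u) (hu1 : ∀ x, |u x| ≤ 1)
    (hu0 : ∫ x, u x ∂μ = 0) : ∫ x, (1 + u x) ∂μ = 1 := by
  rw [integral_add (integrable_const 1) (integrable_of_abs_le_one hu hu1), hu0]
  simp

lemma integral_one_add_mul_self {u : E → ℝ} (hu : Measurable u) (hu1 : ∀ x, |u x| ≤ 1)
    (hu0 : ∫ x, u x ∂μ = 0) :
    ∫ x, (1 + u x) * (1 + u x) ∂μ = 1 + ∫ x, u x ^ 2 ∂μ := by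
  have h : ∀ x, (1 + u x) * (1 + u x) = (1 + u x) + (u x + u x ^ 2) := fun x => by ring
  simp_rw [h]
  have hi := integrable_of_abs_le_one (μ := μ) hu hu1
  have hi2 := integrable_sq_of_abs_le_one (μ := μ) hu hu1
  rw [integral_add (f := fun x => 1 + u x) (g := fun x => u x + u x ^ 2)
    ((integrable_const 1).add hi) (hi.add hi2), integral_one_add hu hu1 hu0,
    integral_add hi hi2, hu0, zero_add]

/-- The cross moment of two opposite perturbations: the linear terms cancel, so it falls below 1 by
as much as the second moment of a centred perturbation exceeds 1. -/
lemma integral_one_add_mul_one_sub {u : E → ℝ} (hu : Measurable u) (hu1 : ∀ x, |u x| ≤ 1) :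
    ∫ x, (1 + u x) * (1 + -u x) ∂μ = 1 - ∫ x, u x ^ 2 ∂μ := by
  have h : ∀ x, (1 + u x) * (1 + -u x) = 1 - u x ^ 2 := fun x => by ring
  simp_rw [h]
  rw [integral_sub (integrable_const 1) (integrable_sq_of_abs_le_one hu hu1)]
  simp

/-- The affinity of two products of symmetric perturbations is bounded from below. -/
lemma half_le_integral_min {m n : ℕ} {u v : E → ℝ} (hu : Measurable u) (hv : Measurable v)
    (hu1 : ∀ x, |u x| ≤ 1) (hv1 : ∀ x, |v x| ≤ 1) (hu0 : ∫ x, u x ∂μ = 0)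
    (hv0 : ∫ x, v x ∂ν = 0) (h : m * ∫ x, u x ^ 2 ∂μ + n * ∫ x, v x ^ 2 ∂ν ≤ 1 / 5) :
    1 / 2 ≤ ∫ z, min (sampleProd (fun x => 1 + u x) (fun x => 1 + v x) z)
        (sampleProd (fun x => 1 + -u x) (fun x => 1 + -v x) z)
      ∂((Measure.pi fun _ : Fin m => μ).prod (Measure.pi fun _ : Fin n => ν)) := by
  set L := (Measure.pi fun _ : Fin m => μ).prod (Measure.pi fun _ : Fin n => ν) with hL
  have hnu1 : ∀ x, |-u x| ≤ 1 := fun x => by rw [abs_neg]; exact hu1 x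
  have hnv1 : ∀ x, |-v x| ≤ 1 := fun x => by rw [abs_neg]; exact hv1 x
  have hnu : Measurable fun x => -u x := hu.neg
  have hnv : Measurable fun x => -v x := hv.neg
  have hnu0 : ∫ x, -u x ∂μ = 0 := by rw [integral_neg, hu0, neg_zero]
  have hnv0 : ∫ x, -v x ∂ν = 0 := by rw [integral_neg, hv0, neg_zero]
  have iu := (integrable_const (1 : ℝ)).add (integrable_of_abs_le_one (μ := μ) hu hu1)
  have iv := (integrable_const (1 : ℝ)).add (integrable_of_abs_le_one (μ := ν) hv hv1)
  have inu := (integrable_const (1 : ℝ)).add (integrable_of_abs_le_one (μ := μ) hnu hnu1)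
  have inv := (integrable_const (1 : ℝ)).add (integrable_of_abs_le_one (μ := ν) hnv hnv1)
  have hprod : ∀ {ρ : Measure E} [IsProbabilityMeasure ρ] {f g : E → ℝ}, Measurable f →
      Measurable g → (∀ x, |f x| ≤ 1) → (∀ x, |g x| ≤ 1) →
      Integrable (fun x => (1 + f x) * (1 + g x)) ρ := by
    intro ρ _ f g hf hg hf1 hg1
    refine Integrable.of_bound (by fun_prop) 4 (ae_of_all _ fun x => ?_)
    have h1 := abs_le.1 (hf1 x)
    have h2 := abs_le.1 (hg1 x)
    rw [Real.norm_eq_abs, abs_le]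
    constructor <;> nlinarith
  set p := (sampleProd (fun x => 1 + u x) (fun x => 1 + v x) :
    (Fin m → E) × (Fin n → E) → ℝ) with hp
  set q := (sampleProd (fun x => 1 + -u x) (fun x => 1 + -v x) :
    (Fin m → E) × (Fin n → E) → ℝ) with hq
  have ip : Integrable p L := integrable_sampleProd iu iv
  have iq : Integrable q L := integrable_sampleProd inu inv
  have ipp : Integrable (fun z => p z * p z) L := by
    simp_rw [hp, sampleProd_mul]
    exact integrable_sampleProd (hprod hu hu hu1 hu1) (hprod hv hv hv1 hv1)
  have iqq : Integrable (fun z => q z * q z) L := by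
    simp_rw [hq, sampleProd_mul]
    exact integrable_sampleProd (hprod hu.neg hnu hnu1 hnu1) (hprod hv.neg hnv hnv1 hnv1)
  have ipq : Integrable (fun z => p z * q z) L := by
    simp_rw [hp, hq, sampleProd_mul]
    exact integrable_sampleProd (hprod hu hnu hu1 hnu1) (hprod hv hnv hv1 hnv1)
  set a := ∫ x, u x ^ 2 ∂μ with ha
  set b := ∫ x, v x ^ 2 ∂ν with hb
  have ep : ∫ z, p z ∂L = 1 := by
    rw [hp, hL, integral_sampleProd, integral_one_add hu hu1 hu0, integral_one_add hv hv1 hv0]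
    simp
  have eq : ∫ z, q z ∂L = 1 := by
    rw [hq, hL, integral_sampleProd, integral_one_add hnu hnu1 hnu0,
      integral_one_add hnv hnv1 hnv0]
    simp
  have epp : ∫ z, p z * p z ∂L = (1 + a) ^ m * (1 + b) ^ n := by
    simp_rw [hp, sampleProd_mul]
    rw [hL, integral_sampleProd, integral_one_add_mul_self hu hu1 hu0,
      integral_one_add_mul_self hv hv1 hv0]
  have eqq : ∫ z, q z * q z ∂L = (1 + a) ^ m * (1 + b) ^ n := by
    simp_rw [hq, sampleProd_mul]
    rw [hL, integral_sampleProd, integral_one_add_mul_self hnu hnu1 hnu0,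
      integral_one_add_mul_self hnv hnv1 hnv0]
    simp_rw [neg_sq]
    rfl
  have epq : ∫ z, p z * q z ∂L = (1 - a) ^ m * (1 - b) ^ n := by
    simp_rw [hp, hq, sampleProd_mul]
    rw [hL, integral_sampleProd, integral_one_add_mul_one_sub hu hu1,
      integral_one_add_mul_one_sub hv hv1]
  have hsq : ∀ {ρ : Measure E} [IsProbabilityMeasure ρ] {f : E → ℝ}, Measurable f →
      (∀ x, |f x| ≤ 1) → ∫ x, f x ^ 2 ∂ρ ≤ 1 := by
    intro ρ _ f hf hf1
    calc ∫ x, f x ^ 2 ∂ρ ≤ ∫ _, (1 : ℝ) ∂ρ := by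
          refine integral_mono (integrable_sq_of_abs_le_one hf hf1) (integrable_const 1) fun x => ?_
          exact (sq_le_one_iff_abs_le_one _).2 (hf1 x)
      _ = 1 := by simp
  have key := moment_bound (m := m) (n := n) (a := a) (b := b)
    (integral_nonneg fun x => sq_nonneg _) (hsq hu hu1) (integral_nonneg fun x => sq_nonneg _)
    (hsq hv hv1) h
  have i1 : Integrable (fun z => 1 / 2 * (p z + q z)) L := (ip.add iq).const_mul _
  have i2 : Integrable (fun z => 1 / 2 * (p z + q z) - 1 / 4) L := i1.sub (integrable_const _)
  have i3 : Integrable (fun z => p z * p z + q z * q z) L := ipp.add iqq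
  have i4 : Integrable (fun z => p z * p z + q z * q z - 2 * (p z * q z)) L :=
    i3.sub (ipq.const_mul 2)
  -- The difference of the two integrands is the square `(|p - q| - 1)² / 4`. This trades the
  -- affinity for second moments, which factorize over the sample. By `moment_bound`, `∫ (p - q)² ≤
  -- 1`, so the lower bound is at least `1 - 1/4 - 1/4`.
  have hmono : ∫ z, (((1 / 2) * (p z + q z) - 1 / 4) -
      (1 / 4) * ((p z * p z + q z * q z) - 2 * (p z * q z))) ∂L ≤
      ∫ z, min (p z) (q z) ∂L := by
    refine integral_mono (i2.sub (i4.const_mul _)) (ip.inf iq) fun z => ?_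
    rcases le_total (p z) (q z) with hz | hz
    · simp only [min_eq_left hz]
      nlinarith [sq_nonneg (q z - p z - 1)]
    · simp only [min_eq_right hz]
      nlinarith [sq_nonneg (p z - q z - 1)]
  refine le_trans ?_ hmono
  rw [integral_sub i2 (i4.const_mul _), integral_sub i1 (integrable_const _),
    integral_const_mul, integral_add ip iq, integral_const_mul, integral_sub i3 (ipq.const_mul 2),
    integral_add ipp iqq, integral_const_mul, ep, eq, epp, eqq, epq]
  simp
  linarith

/-- The law of a perturbed sample has a density with respect to the unperturbed one. -/
lemma prod_pi_withDensity {m n : ℕ} {u v : E → ℝ} (hu : Measurable u) (hv : Measurable v)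
    (hu1 : ∀ x, |u x| ≤ 1) (hv1 : ∀ x, |v x| ≤ 1) :
    (Measure.pi fun _ : Fin m => μ.withDensity fun x => ENNReal.ofReal (1 + u x)).prod
      (Measure.pi fun _ : Fin n => ν.withDensity fun x => ENNReal.ofReal (1 + v x)) =
    ((Measure.pi fun _ : Fin m => μ).prod (Measure.pi fun _ : Fin n => ν)).withDensity
      fun z => ENNReal.ofReal (sampleProd (fun x => 1 + u x) (fun x => 1 + v x) z) := by
  have iu := (integrable_const (1 : ℝ)).add (integrable_of_abs_le_one (μ := μ) hu hu1)
  have iv := (integrable_const (1 : ℝ)).add (integrable_of_abs_le_one (μ := ν) hv hv1)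
  have hu2 : ∀ x, 0 ≤ 1 + u x := fun x => by linarith [(abs_le.1 (hu1 x)).1]
  have hv2 : ∀ x, 0 ≤ 1 + v x := fun x => by linarith [(abs_le.1 (hv1 x)).1]
  have := isFiniteMeasure_withDensity_ofReal iu.2
  have := isFiniteMeasure_withDensity_ofReal iv.2
  have hmu : Measurable fun z : Fin m → E => ENNReal.ofReal (∏ i, (1 + u (z i))) := by fun_prop
  have hmv : Measurable fun z : Fin n → E => ENNReal.ofReal (∏ i, (1 + v (z i))) := by fun_prop
  rw [pi_withDensity_ofReal m μ hu2 iu, pi_withDensity_ofReal n ν hv2 iv]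
  have := prod_withDensity (μ := Measure.pi fun _ : Fin m => μ)
    (ν := Measure.pi fun _ : Fin n => ν) hmu hmv
  rw [this]
  congr 1
  ext z
  rw [sampleProd, ENNReal.ofReal_mul (Finset.prod_nonneg fun i _ => hu2 _)]

/-- Le Cam's two point bound for two symmetric perturbations of a pair of sample laws. -/
lemma two_point_bound {m n : ℕ} {u v : E → ℝ} (hu : Measurable u) (hv : Measurable v)
    (hu1 : ∀ x, |u x| ≤ 1) (hv1 : ∀ x, |v x| ≤ 1) (hu0 : ∫ x, u x ∂μ = 0)
    (hv0 : ∫ x, v x ∂ν = 0) (h : m * ∫ x, u x ^ 2 ∂μ + n * ∫ x, v x ^ 2 ∂ν ≤ 1 / 5)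
    {w : ENNReal} {A B : (Fin m → E) × (Fin n → E) → ENNReal}
    (hA : Measurable A) (hB : Measurable B) (hAB : ∀ z, w ≤ A z + B z) :
    w * ENNReal.ofReal (1 / 2) ≤
      ∫⁻ z, A z ∂((Measure.pi fun _ : Fin m => μ.withDensity fun x => ENNReal.ofReal (1 + u x)).prod
        (Measure.pi fun _ : Fin n => ν.withDensity fun x => ENNReal.ofReal (1 + v x))) +
      ∫⁻ z, B z ∂((Measure.pi fun _ : Fin m => μ.withDensity fun x => ENNReal.ofReal (1 + -u x)).prod
        (Measure.pi fun _ : Fin n => ν.withDensity fun x => ENNReal.ofReal (1 + -v x))) := by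
  have hnu1 : ∀ x, |-u x| ≤ 1 := fun x => by rw [abs_neg]; exact hu1 x
  have hnv1 : ∀ x, |-v x| ≤ 1 := fun x => by rw [abs_neg]; exact hv1 x
  have hnu : Measurable fun x => -u x := hu.neg
  have hnv : Measurable fun x => -v x := hv.neg
  rw [prod_pi_withDensity hu hv hu1 hv1, prod_pi_withDensity hnu hnv hnu1 hnv1]
  set L := (Measure.pi fun _ : Fin m => μ).prod (Measure.pi fun _ : Fin n => ν) with hL
  have mp := measurable_sampleProd (m := m) (n := n) (hu.const_add 1) (hv.const_add 1)
  have mq := measurable_sampleProd (m := m) (n := n) (hnu.const_add 1) (hnv.const_add 1)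
  rw [lintegral_withDensity_eq_lintegral_mul _ mp.ennreal_ofReal hA,
    lintegral_withDensity_eq_lintegral_mul _ mq.ennreal_ofReal hB,
    ← lintegral_add_left (mp.ennreal_ofReal.mul hA)]
  have ip : Integrable _ L := integrable_sampleProd (m := m) (n := n)
    ((integrable_const 1).add (integrable_of_abs_le_one (μ := μ) hu hu1))
    ((integrable_const 1).add (integrable_of_abs_le_one (μ := ν) hv hv1))
  have iq : Integrable _ L := integrable_sampleProd (m := m) (n := n)
    ((integrable_const 1).add (integrable_of_abs_le_one (μ := μ) hnu hnu1))
    ((integrable_const 1).add (integrable_of_abs_le_one (μ := ν) hnv hnv1))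
  have hge : ∀ {f : E → ℝ}, (∀ x, |f x| ≤ 1) → ∀ x, 0 ≤ 1 + f x :=
    fun hf x => by linarith [(abs_le.1 (hf x)).1]
  have hmin := half_le_integral_min (m := m) (n := n) hu hv hu1 hv1 hu0 hv0 h
  -- With `p` and `q` the two densities, `A p + B q ≥ (A + B) min p q ≥ w min p q`.
  calc w * ENNReal.ofReal (1 / 2)
      ≤ w * ∫⁻ z, ENNReal.ofReal (min (sampleProd (fun x => 1 + u x) (fun x => 1 + v x) z)
        (sampleProd (fun x => 1 + -u x) (fun x => 1 + -v x) z)) ∂L := by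
        gcongr
        refine (ENNReal.ofReal_le_ofReal hmin).trans ?_
        refine (ofReal_integral_eq_lintegral_ofReal (ip.inf iq) (ae_of_all _ fun z => ?_)).le
        exact le_min (sampleProd_nonneg (hge hu1) (hge hv1) z)
          (sampleProd_nonneg (hge hnu1) (hge hnv1) z)
    _ = ∫⁻ z, w * ENNReal.ofReal (min (sampleProd (fun x => 1 + u x) (fun x => 1 + v x) z)
        (sampleProd (fun x => 1 + -u x) (fun x => 1 + -v x) z)) ∂L := by
        rw [lintegral_const_mul _ (mp.min mq).ennreal_ofReal]
    _ ≤ _ := by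
        refine lintegral_mono fun z => ?_
        simp only [Pi.mul_apply]
        calc _ ≤ (A z + B z) * ENNReal.ofReal _ := by gcongr; exact hAB z
          _ ≤ _ := by
            rw [add_mul, mul_comm (A z), mul_comm (B z)]
            gcongr
            · exact min_le_left _ _
            · exact min_le_right _ _

end Testing

section Labelled

/-! ### Distributions with a prescribed regression function -/

/-- The sign of a label: `1` for the label `1`, and `-1` for the label `0`. -/
def labelSign (y : Fin 2) : ℝ := if y = 1 then 1 else -1

@[simp] lemma labelSign_zero : labelSign 0 = -1 := by simp [labelSign]
@[simp] lemma labelSign_one : labelSign 1 = 1 := by simp [labelSign]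

lemma measurable_labelSign : Measurable labelSign := measurable_of_countable _

lemma abs_labelSign (y : Fin 2) : |labelSign y| = 1 := by
  fin_cases y <;> simp

/-- The law of `(X, Y)` with `X` of law `U` and `Y = 1` with conditional probability
`1 / 2 + s X`. -/
def labelledMeasure {d : ℕ} (U : Measure (Cov d)) (s : Cov d → ℝ) : Measure (Obs d) :=
  (U.prod Measure.count).withDensity fun z => ENNReal.ofReal (1 / 2 + s z.1 * labelSign z.2)

variable {d : ℕ} {U : Measure (Cov d)} {s : Cov d → ℝ}

/-- A perturbation of the regression function where it equals `1 / 2` is a reweighting. -/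
lemma labelledMeasure_add {t : Cov d → ℝ} (hs : Measurable s) (ht : Measurable t)
    (hs1 : ∀ x, |s x| ≤ 1 / 2) (hst : ∀ x, s x * t x = 0) :
    labelledMeasure U (fun x => s x + t x) =
      (labelledMeasure U s).withDensity
        fun z => ENNReal.ofReal (1 + 2 * t z.1 * labelSign z.2) := by
  have hm : ∀ {s : Cov d → ℝ}, Measurable s →
      Measurable fun z : Obs d => s z.1 * labelSign z.2 := fun hs =>
    (hs.comp measurable_fst).mul (measurable_labelSign.comp measurable_snd)
  have h1 : Measurable fun z : Obs d => ENNReal.ofReal (1 / 2 + s z.1 * labelSign z.2) :=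
    ((hm hs).const_add _).ennreal_ofReal
  have h2 : Measurable fun z : Obs d => ENNReal.ofReal (1 + 2 * t z.1 * labelSign z.2) :=
    ((hm (ht.const_mul 2)).const_add _).ennreal_ofReal
  rw [labelledMeasure, labelledMeasure, ← withDensity_mul _ h1 h2]
  congr 1
  ext z
  have hb : |s z.1 * labelSign z.2| ≤ 1 / 2 := by
    rw [abs_mul, abs_labelSign, mul_one]; exact hs1 z.1
  rw [Pi.mul_apply, ← ENNReal.ofReal_mul (by linarith [(abs_le.1 hb).1])]
  congr 1
  -- In `(1/2 + s ε)(1 + 2 t ε)` the only unwanted term is `2 s t ε²`, and `s t = 0`.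
  linear_combination (-2 * labelSign z.2 ^ 2) * hst z.1

lemma lintegral_labelledMeasure [SFinite U] (hs : Measurable s) {F : Obs d → ENNReal} (hF : Measurable F) :
    ∫⁻ z, F z ∂(labelledMeasure U s) =
      ∫⁻ x, (ENNReal.ofReal (1 / 2 - s x) * F (x, 0) +
        ENNReal.ofReal (1 / 2 + s x) * F (x, 1)) ∂U := by
  have hm : Measurable fun z : Obs d => ENNReal.ofReal (1 / 2 + s z.1 * labelSign z.2) :=
    (((hs.comp measurable_fst).mul (measurable_labelSign.comp measurable_snd)).const_add
      _).ennreal_ofReal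
  rw [labelledMeasure, lintegral_withDensity_eq_lintegral_mul _ hm hF,
    lintegral_prod _ (hm.mul hF).aemeasurable]
  refine lintegral_congr fun x => ?_
  rw [lintegral_count, tsum_fintype, Fin.sum_univ_two]
  simp [sub_eq_add_neg]

variable [IsProbabilityMeasure U]

lemma ofReal_add_ofReal_eq_one {t : ℝ} (ht : |t| ≤ 1 / 2) :
    ENNReal.ofReal (1 / 2 - t) + ENNReal.ofReal (1 / 2 + t) = 1 := by
  have := abs_le.1 ht
  rw [← ENNReal.ofReal_add (by linarith) (by linarith)]
  norm_num

lemma labelledMeasure_prod_univ (hs : Measurable s) (hs1 : ∀ x, |s x| ≤ 1 / 2) {A : Set (Cov d)}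
    (hA : MeasurableSet A) : labelledMeasure U s (A ×ˢ Set.univ) = U A := by
  rw [← lintegral_indicator_one (hA.prod MeasurableSet.univ), lintegral_labelledMeasure hs
    (measurable_one.indicator (hA.prod MeasurableSet.univ)), ← lintegral_indicator_one hA]
  refine lintegral_congr fun x => ?_
  by_cases hx : x ∈ A
  · simpa [hx] using ofReal_add_ofReal_eq_one (hs1 x)
  · simp [hx]

lemma isProbabilityMeasure_labelledMeasure (hs : Measurable s) (hs1 : ∀ x, |s x| ≤ 1 / 2) :
    IsProbabilityMeasure (labelledMeasure U s) := by
  constructor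
  rw [← Set.univ_prod_univ, labelledMeasure_prod_univ hs hs1 MeasurableSet.univ, measure_univ]

/-- `labelledMeasure` as a bundled probability measure. -/
def labelled (U : Measure (Cov d)) [IsProbabilityMeasure U] (s : Cov d → ℝ) (hs : Measurable s)
    (hs1 : ∀ x, |s x| ≤ 1 / 2) : ProbabilityMeasure (Obs d) :=
  ⟨labelledMeasure U s, isProbabilityMeasure_labelledMeasure hs hs1⟩

@[simp] lemma coe_labelled (hs : Measurable s) (hs1 : ∀ x, |s x| ≤ 1 / 2) :
    (labelled U s hs hs1 : Measure (Obs d)) = labelledMeasure U s := rfl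

lemma marginal_labelled (hs : Measurable s) (hs1 : ∀ x, |s x| ≤ 1 / 2) :
    marginal (labelled U s hs hs1) = U := by
  ext A hA
  rw [marginal, Measure.fst_apply hA, coe_labelled, ← Set.prod_univ,
    labelledMeasure_prod_univ hs hs1 hA]

/-- The conditional kernel is identified by integrating over sets of covariates. The conventional
value of `eta` off the support plays no role, because almost every point lies in the support. -/
lemma eta_labelled (hs : Measurable s) (hs1 : ∀ x, |s x| ≤ 1 / 2) :
    ∀ᵐ x ∂U, eta (labelled U s hs hs1) x = 1 / 2 + s x := by
  set G := labelled U s hs hs1 with hG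
  have hm : marginal G = U := marginal_labelled hs hs1
  have hm' : (G : Measure (Obs d)).fst = U := hm
  have hcond : (fun x => (G : Measure (Obs d)).condKernel x {1}) =ᵐ[U]
      fun x => ENNReal.ofReal (1 / 2 + s x) := by
    refine ae_eq_of_forall_setLIntegral_eq_of_sigmaFinite
      (Kernel.measurable_coe _ (measurableSet_singleton _)) (by fun_prop) fun A hA _ => ?_
    have h := Measure.setLIntegral_condKernel_eq_measure_prod (ρ := (G : Measure (Obs d))) hA
      (measurableSet_singleton (1 : Fin 2))
    rw [hm'] at h
    rw [h, hG, coe_labelled, ← lintegral_indicator_one (hA.prod (measurableSet_singleton _)),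
      lintegral_labelledMeasure hs
        (measurable_one.indicator (hA.prod (measurableSet_singleton _))),
      ← lintegral_indicator hA]
    refine lintegral_congr fun x => ?_
    by_cases hx : x ∈ A <;> simp [hx]
  have hsupp : ∀ᵐ x ∂U, x ∈ U.support := Measure.support_mem_ae
  filter_upwards [hcond, hsupp] with x hx hx'
  rw [eta, hm, if_pos hx', measureReal_def, hx, ENNReal.toReal_ofReal]
  linarith [(abs_le.1 (hs1 x)).1]

lemma integrable_of_abs_le {s : Cov d → ℝ} (hs : Measurable s) {C : ℝ} (hs1 : ∀ x, |s x| ≤ C) :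
    Integrable s U :=
  Integrable.of_bound hs.aestronglyMeasurable C (ae_of_all _ hs1)

/-- The risk of a classifier, as an integral over the covariate. -/
lemma risk_labelled (hs : Measurable s) (hs1 : ∀ x, |s x| ≤ 1 / 2) {f g : Cov d → Fin 2}
    (hf : Measurable f) (hfg : g =ᵐ[U] f) :
    risk (labelled U s hs hs1) g = ∫ x, (1 / 2 - s x * labelSign (f x)) ∂U := by
  have hbd : ∀ x, |s x * labelSign (f x)| ≤ 1 / 2 := fun x => by
    rw [abs_mul, abs_labelSign, mul_one]; exact hs1 x
  have hsf : Measurable fun x => s x * labelSign (f x) := hs.mul (measurable_labelSign.comp hf)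
  have hset : MeasurableSet {z : Obs d | z.2 ≠ f z.1} :=
    (measurableSet_eq_fun measurable_snd (hf.comp measurable_fst)).compl
  -- The Bayes classifier is identified only almost everywhere, so its error event is replaced by
  -- that of a measurable version; the null set is transported through the first marginal.
  have hae : {z : Obs d | z.2 ≠ g z.1} =ᵐ[labelledMeasure U s] {z : Obs d | z.2 ≠ f z.1} := by
    have hm : (labelledMeasure U s).fst = U := marginal_labelled hs hs1
    have h : ∀ᵐ z ∂labelledMeasure U s, g z.1 = f z.1 := by
      rw [← hm, Measure.fst] at hfg
      exact ae_of_ae_map measurable_fst.aemeasurable hfg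
    filter_upwards [h] with z hz
    exact propext (show z.2 ≠ g z.1 ↔ z.2 ≠ f z.1 by rw [hz])
  rw [risk, coe_labelled, measureReal_def, measure_congr hae, ← lintegral_indicator_one hset,
    lintegral_labelledMeasure hs (measurable_one.indicator hset),
    integral_eq_lintegral_of_nonneg_ae
      (ae_of_all _ fun x => by
        have := (abs_le.1 (hbd x)).2
        simp only [Pi.zero_apply]
        linarith)
      ((hsf.const_sub _).aestronglyMeasurable)]
  congr 1
  refine lintegral_congr fun x => ?_
  rcases Fin.exists_fin_two.1 ⟨f x, rfl⟩ with h | h <;> simp [h]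

/-- The Bayes rule chooses the sign of `s` and so attains `|s|` pointwise. The integrand is `2 |s|`
where `f` errs and `0` elsewhere, hence the excess risk is a sum of local losses. -/
lemma excessRisk_labelled (hs : Measurable s) (hs1 : ∀ x, |s x| ≤ 1 / 2) {f : Cov d → Fin 2}
    (hf : Measurable f) :
    excessRisk (labelled U s hs hs1) f =
      ∫ x, (|s x| - s x * labelSign (f x)) ∂U := by
  classical
  set b : Cov d → Fin 2 := fun x => if 1 / 2 + s x ≤ 1 / 2 then 0 else 1 with hb
  have hbm : Measurable b :=
    Measurable.ite (measurableSet_le (hs.const_add _) measurable_const) measurable_const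
      measurable_const
  have hbayes : bayes (labelled U s hs hs1) =ᵐ[U] b := by
    filter_upwards [eta_labelled (U := U) hs hs1] with x hx
    rw [bayes, hx]
  have hsb : ∀ x, s x * labelSign (b x) = |s x| := by
    intro x
    by_cases h : s x ≤ 0
    · simp [hb, h, abs_of_nonpos h]
    · simp [hb, h, abs_of_pos (not_le.1 h)]
  have hbd : ∀ f : Cov d → Fin 2, ∀ x, |s x * labelSign (f x)| ≤ 1 / 2 := fun f x => by
    rw [abs_mul, abs_labelSign, mul_one]; exact hs1 x
  have hi : ∀ {f : Cov d → Fin 2}, Measurable f →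
      Integrable (fun x => 1 / 2 - s x * labelSign (f x)) U := fun hf =>
    (integrable_const _).sub (integrable_of_abs_le (hs.mul (measurable_labelSign.comp hf)) (hbd _))
  rw [excessRisk, risk_labelled hs hs1 hf (ae_eq_refl f), risk_labelled hs hs1 hbm hbayes,
    ← integral_sub (hi hf) (hi hbm)]
  refine integral_congr_ae (ae_of_all _ fun x => ?_)
  simp only [hsb]
  ring

/-- Integrals against a `labelledMeasure`. -/
lemma integral_labelledMeasure (hs : Measurable s) (hs1 : ∀ x, |s x| ≤ 1 / 2) {F : Obs d → ℝ}
    (hF : Measurable F) {C : ℝ} (hC : ∀ z, |F z| ≤ C) :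
    ∫ z, F z ∂(labelledMeasure U s) =
      ∫ x, ((1 / 2 - s x) * F (x, 0) + (1 / 2 + s x) * F (x, 1)) ∂U := by
  have hsm : Measurable fun z : Obs d => 1 / 2 + s z.1 * labelSign z.2 :=
    ((hs.comp measurable_fst).mul (measurable_labelSign.comp measurable_snd)).const_add _
  have hsb : ∀ z : Obs d, |s z.1 * labelSign z.2| ≤ 1 / 2 := fun z => by
    rw [abs_mul, abs_labelSign, mul_one]; exact hs1 z.1
  have h0 : ∀ z : Obs d, 0 ≤ 1 / 2 + s z.1 * labelSign z.2 := fun z => by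
    linarith [(abs_le.1 (hsb z)).1]
  have hint : Integrable (fun z : Obs d => (1 / 2 + s z.1 * labelSign z.2) * F z)
      (U.prod Measure.count) := by
    refine Integrable.of_bound (hsm.mul hF).aestronglyMeasurable C (ae_of_all _ fun z => ?_)
    rw [Real.norm_eq_abs, abs_mul, abs_of_nonneg (h0 z)]
    have := (abs_le.1 (hsb z)).2
    calc (1 / 2 + s z.1 * labelSign z.2) * |F z| ≤ 1 * |F z| := by gcongr; linarith
      _ ≤ C := by rw [one_mul]; exact hC z
  rw [labelledMeasure, integral_withDensity_eq_integral_toReal_smul hsm.ennreal_ofReal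
    (ae_of_all _ fun z => ENNReal.ofReal_lt_top)]
  simp_rw [ENNReal.toReal_ofReal (h0 _), smul_eq_mul]
  rw [integral_prod _ hint]
  refine integral_congr_ae (ae_of_all _ fun x => ?_)
  simp only [integral_count, Fin.sum_univ_two, labelSign_zero, labelSign_one]
  ring

/-- The first two moments of the relative perturbation. -/
lemma integral_perturbation {t : Cov d → ℝ} (hs : Measurable s) (ht : Measurable t)
    (hs1 : ∀ x, |s x| ≤ 1 / 2) (ht1 : ∀ x, |t x| ≤ 1 / 2) (hst : ∀ x, s x * t x = 0) :
    ∫ z, 2 * t z.1 * labelSign z.2 ∂(labelledMeasure U s) = 0 ∧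
      ∫ z, (2 * t z.1 * labelSign z.2) ^ 2 ∂(labelledMeasure U s) = 4 * ∫ x, t x ^ 2 ∂U := by
  have hm : Measurable fun z : Obs d => 2 * t z.1 * labelSign z.2 :=
    ((ht.comp measurable_fst).const_mul 2).mul (measurable_labelSign.comp measurable_snd)
  have hb : ∀ z : Obs d, |2 * t z.1 * labelSign z.2| ≤ 1 := fun z => by
    rw [abs_mul, abs_labelSign, mul_one, abs_mul, abs_two]; linarith [ht1 z.1]
  constructor
  · rw [integral_labelledMeasure hs hs1 hm hb]
    have : ∀ x, (1 / 2 - s x) * (2 * t x * labelSign 0) +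
        (1 / 2 + s x) * (2 * t x * labelSign 1) = 0 := fun x => by
      rw [labelSign_zero, labelSign_one]
      linear_combination 4 * hst x
    rw [integral_congr_ae (ae_of_all _ this), integral_zero]
  · rw [integral_labelledMeasure hs hs1 (hm.pow_const 2) (C := 1) fun z => by
      rw [abs_pow]; exact pow_le_one₀ (abs_nonneg _) (hb z), ← integral_const_mul]
    refine integral_congr_ae (ae_of_all _ fun x => ?_)
    simp only [labelSign_zero, labelSign_one]
    ring

end Labelled

/-! ### The uniform law on the grid -/

/-- The uniform law on the grid. -/
def gridLaw (d M : ℕ) (a : ℝ) : Measure (Cov d) := ProbabilityTheory.cond volume (grid d M a)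

section GridLaw

variable {d M : ℕ} {a : ℝ}

lemma gridLaw_eq_smul (hM : 0 < M) (ha0 : 0 < a) (ha1 : a < 1) :
    gridLaw d M a = (ENNReal.ofReal (a ^ d))⁻¹ • volume.restrict (grid d M a) := by
  rw [gridLaw, ProbabilityTheory.cond, volume_grid hM ha0 ha1]

lemma isProbabilityMeasure_gridLaw (hM : 0 < M) (ha0 : 0 < a) (ha1 : a < 1) :
    IsProbabilityMeasure (gridLaw d M a) := by
  refine cond_isProbabilityMeasure_of_finite ?_ ?_ <;> rw [volume_grid hM ha0 ha1]
  · simpa using pow_pos ha0 d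
  · exact ENNReal.ofReal_ne_top

lemma gridLaw_cell (hM : 0 < M) (ha0 : 0 < a) (ha1 : a < 1) (k : Fin d → Fin M) :
    gridLaw d M a (cell a k) = ENNReal.ofReal (((M : ℝ) ^ d)⁻¹) := by
  have hM' : (0 : ℝ) < M := by exact_mod_cast hM
  rw [gridLaw_eq_smul hM ha0 ha1, Measure.smul_apply, Measure.restrict_apply
    (measurableSet_cell a k), Set.inter_eq_left.2 (cell_subset_grid a k), volume_cell ha0,
    ← ENNReal.ofReal_inv_of_pos (pow_pos ha0 d), smul_eq_mul,
    ← ENNReal.ofReal_mul (by positivity), div_pow]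
  congr 1
  field_simp

lemma ae_mem_grid : ∀ᵐ x ∂gridLaw d M a, x ∈ grid d M a :=
  ae_cond_mem (isClosed_grid d M a).measurableSet

lemma gridLaw_ac : gridLaw d M a ≪ volume := cond_absolutelyContinuous

/-- No point of the closed grid is lost: by regularity every small ball around it meets the grid in
positive volume. -/
lemma support_gridLaw (hd : 0 < d) (hM : 0 < M) (ha0 : 0 < a) (ha1 : a < 1) :
    (gridLaw d M a).support = grid d M a := by
  refine subset_antisymm (Measure.support_subset_of_isClosed (isClosed_grid d M a) ae_mem_grid)
    fun x hx => ?_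
  rw [Measure.mem_support_iff_forall]
  intro V hV
  obtain ⟨ε, hε, hball⟩ := Metric.nhds_basis_closedBall.mem_iff.1 hV
  set r := min ε 1 with hr
  have hr0 : 0 < r := lt_min hε one_pos
  have hreg := grid_regular hd ha0 ha1 le_rfl hx hr0 (min_le_right _ _)
  have hpos : 0 < volume (grid d M a ∩ Metric.closedBall x r) := by
    refine lt_of_lt_of_le (ENNReal.mul_pos ?_ ?_) hreg
    · simpa using gridRegularity_pos hd ha0 one_pos
    · exact (Metric.measure_closedBall_pos _ _ hr0).ne'
  have hsub : Metric.closedBall x r ⊆ V :=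
    (Metric.closedBall_subset_closedBall (min_le_left _ _)).trans hball
  refine lt_of_lt_of_le ?_ (measure_mono hsub)
  rw [gridLaw_eq_smul hM ha0 ha1, Measure.smul_apply,
    Measure.restrict_apply Metric.isClosed_closedBall.measurableSet, Set.inter_comm]
  exact ENNReal.mul_pos (ENNReal.inv_ne_zero.2 ENNReal.ofReal_ne_top) hpos.ne'

lemma rnDeriv_gridLaw (hM : 0 < M) (ha0 : 0 < a) (ha1 : a < 1) :
    ∀ᵐ x ∂(volume.restrict (grid d M a)),
      (gridLaw d M a).rnDeriv volume x = ENNReal.ofReal ((a ^ d)⁻¹) := by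
  have hm : MeasurableSet (grid d M a) := (isClosed_grid d M a).measurableSet
  have h : gridLaw d M a = volume.withDensity
      ((grid d M a).indicator fun _ => ENNReal.ofReal ((a ^ d)⁻¹)) := by
    rw [gridLaw_eq_smul hM ha0 ha1, withDensity_indicator hm, withDensity_const,
      ENNReal.ofReal_inv_of_pos (pow_pos ha0 d)]
  have h2 := Measure.rnDeriv_withDensity (volume : Measure (Cov d))
    ((measurable_const (a := ENNReal.ofReal ((a ^ d)⁻¹))).indicator hm)
  rw [← h] at h2
  filter_upwards [ae_restrict_of_ae h2, ae_restrict_mem hm] with x hx hx'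
  rw [hx, Set.indicator_of_mem hx']

lemma strongDensity_of_marginal (hd : 0 < d) (hM : 0 < M) (ha0 : 0 < a) (ha1 : a < 1)
    {μ₁ μ₂ cμ rμ : ℝ} (hμ₁ : 0 < μ₁) (h1 : μ₁ < (a ^ d)⁻¹) (h2 : (a ^ d)⁻¹ < μ₂)
    (hc : cμ ≤ gridRegularity d a (max rμ 1))
    {P Q : ProbabilityMeasure (Obs d)} (hP : marginal P = gridLaw d M a)
    (hQ : marginal Q = gridLaw d M a) : StrongDensity μ₁ μ₂ cμ rμ P Q := by
  have hdens : ∀ᵐ x ∂(volume.restrict (grid d M a)),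
      ENNReal.ofReal μ₁ < (gridLaw d M a).rnDeriv volume x ∧
        (gridLaw d M a).rnDeriv volume x < ENNReal.ofReal μ₂ := by
    filter_upwards [rnDeriv_gridLaw hM ha0 ha1] with x hx
    rw [hx]
    exact ⟨(ENNReal.ofReal_lt_ofReal_iff (by linarith)).2 h1,
      (ENNReal.ofReal_lt_ofReal_iff (by linarith)).2 h2⟩
  constructor
  · rw [hP]; exact gridLaw_ac
  · rw [hQ]; exact gridLaw_ac
  · rw [hP, hQ]
  · rw [hQ, support_gridLaw hd hM ha0 ha1]
    intro x hx r hr0 hr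
    refine le_trans ?_ (grid_regular hd ha0 ha1 (le_max_right rμ 1) hx hr0
      (hr.trans (le_max_left _ _)))
    gcongr
  · rw [hP, hQ, support_gridLaw hd hM ha0 ha1]; exact hdens
  · rw [hQ, support_gridLaw hd hM ha0 ha1]; exact hdens

end GridLaw

/-! ### Functions that are constant on the cells -/

/-- The function with value `c k` on the cell `k` and `0` off the grid. -/
def stepFn {d M : ℕ} (a : ℝ) (c : (Fin d → Fin M) → ℝ) (x : Cov d) : ℝ :=
  ∑ k, (cell a k).indicator (fun _ => c k) x

section StepFn

variable {d M : ℕ} {a : ℝ}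

lemma measurable_stepFn (c : (Fin d → Fin M) → ℝ) : Measurable (stepFn a c) :=
  Finset.measurable_sum _ fun k _ => measurable_const.indicator (measurableSet_cell a k)

lemma stepFn_of_mem (ha : a < 1) (c : (Fin d → Fin M) → ℝ) {k : Fin d → Fin M} {x : Cov d}
    (hx : x ∈ cell a k) : stepFn a c x = c k := by
  rw [stepFn, Finset.sum_eq_single k, Set.indicator_of_mem hx]
  · intro l _ hl
    exact Set.indicator_of_notMem (fun h => hl (cell_unique ha h hx)) _
  · simp

lemma stepFn_of_notMem (c : (Fin d → Fin M) → ℝ) {x : Cov d} (hx : x ∉ grid d M a) :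
    stepFn a c x = 0 :=
  Finset.sum_eq_zero fun k _ => Set.indicator_of_notMem (fun h => hx (cell_subset_grid a k h)) _

lemma stepFn_add (c c' : (Fin d → Fin M) → ℝ) (x : Cov d) :
    stepFn a (c + c') x = stepFn a c x + stepFn a c' x := by
  simp only [stepFn, ← Finset.sum_add_distrib]
  refine Finset.sum_congr rfl fun k _ => ?_
  by_cases hx : x ∈ cell a k <;> simp [hx]

lemma abs_stepFn_le (ha : a < 1) {c : (Fin d → Fin M) → ℝ} {B : ℝ} (hB : 0 ≤ B)
    (hc : ∀ k, |c k| ≤ B) (x : Cov d) : |stepFn a c x| ≤ B := by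
  by_cases hx : x ∈ grid d M a
  · obtain ⟨k, hk⟩ := mem_grid_iff.1 hx
    rw [stepFn_of_mem ha c hk]; exact hc k
  · rw [stepFn_of_notMem c hx, abs_zero]; exact hB

lemma stepFn_mul_eq_zero (ha : a < 1) {c c' : (Fin d → Fin M) → ℝ} (h : ∀ k, c k * c' k = 0)
    (x : Cov d) : stepFn a c x * stepFn a c' x = 0 := by
  by_cases hx : x ∈ grid d M a
  · obtain ⟨k, hk⟩ := mem_grid_iff.1 hx
    rw [stepFn_of_mem ha c hk, stepFn_of_mem ha c' hk, h]
  · rw [stepFn_of_notMem c hx, zero_mul]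

lemma stepFn_single (k : Fin d → Fin M) (τ : ℝ) :
    stepFn a (Pi.single k τ) = (cell a k).indicator fun _ => τ := by
  ext x
  rw [stepFn, Finset.sum_eq_single k]
  · simp
  · intro l _ hl
    simp [hl]
  · simp

lemma integral_stepFn_single_sq (hM : 0 < M) (ha0 : 0 < a) (ha : a < 1) (k : Fin d → Fin M)
    (τ : ℝ) : ∫ x, stepFn a (Pi.single k τ) x ^ 2 ∂gridLaw d M a = τ ^ 2 * ((M : ℝ) ^ d)⁻¹ := by
  have : ∀ x : Cov d, stepFn a (Pi.single k τ) x ^ 2 =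
      (cell a k).indicator (fun _ => τ ^ 2) x := by
    intro x
    rw [stepFn_single]
    by_cases hx : x ∈ cell a k <;> simp [hx]
  simp_rw [this]
  rw [integral_indicator_const _ (measurableSet_cell a k), measureReal_def,
    gridLaw_cell hM ha0 ha, ENNReal.toReal_ofReal (by positivity), smul_eq_mul, mul_comm]

/-- McShane's extension of a Hölder function from a subset to the whole space. -/
lemma exists_mem_holderClass_eqOn {S : Set (Cov d)} {f : Cov d → ℝ} {β C B : ℝ} (hβ0 : 0 < β)
    (hβ1 : β ≤ 1) (hC : 0 < C) (hB : ∀ x ∈ S, |f x| ≤ B)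
    (hf : ∀ x ∈ S, ∀ y ∈ S, |f x - f y| ≤ C * ‖x - y‖ ^ β) :
    ∃ g ∈ HolderClass d β C, ∀ x ∈ S, g x = f x := by
  rcases S.eq_empty_or_nonempty with rfl | hS
  · refine ⟨0, fun x y => ?_, by simp⟩
    simp only [Pi.zero_apply, sub_zero, abs_zero]
    positivity
  have : Nonempty S := hS.to_subtype
  have hbdd : ∀ x, BddBelow (Set.range fun y : S => f y + C * ‖x - (y : Cov d)‖ ^ β) := by
    refine fun x => ⟨-B, ?_⟩
    rintro _ ⟨y, rfl⟩
    have h1 := (abs_le.1 (hB y y.2)).1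
    have h2 : 0 ≤ C * ‖x - y‖ ^ β := by positivity
    simp only
    linarith
  have hle : ∀ x x', (⨅ y : S, f y + C * ‖x - (y : Cov d)‖ ^ β) - C * ‖x - x'‖ ^ β ≤
      ⨅ y : S, f y + C * ‖x' - (y : Cov d)‖ ^ β := by
    refine fun x x' => le_ciInf fun y => ?_
    have h1 := ciInf_le (hbdd x) y
    -- For `β ≤ 1` the power `‖·‖ ^ β` is subadditive, so it satisfies the triangle inequality that
    -- McShane's infimum needs.
    have h2 : ‖x - y‖ ^ β ≤ ‖x - x'‖ ^ β + ‖x' - y‖ ^ β :=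
      (Real.rpow_le_rpow (norm_nonneg _) (norm_sub_le_norm_sub_add_norm_sub _ _ _) hβ0.le).trans
        (Real.rpow_add_le_add_rpow (norm_nonneg _) (norm_nonneg _) hβ0.le hβ1)
    nlinarith
  refine ⟨fun x => ⨅ y : S, f y + C * ‖x - (y : Cov d)‖ ^ β, fun x x' => ?_, fun x hx => ?_⟩
  · have h1 := hle x x'
    have h2 := hle x' x
    rw [norm_sub_rev x' x] at h2
    rw [abs_le]
    constructor <;> linarith
  · refine le_antisymm ?_ (le_ciInf fun y => ?_)
    · refine (ciInf_le (hbdd x) ⟨x, hx⟩).trans ?_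
      simp [Real.zero_rpow hβ0.ne']
    · linarith [(abs_le.1 (hf x hx y y.2)).2]

/-- A step function with jumps that are small compared with the gaps extends to a Hölder
function. -/
lemma exists_holder_extension (ha : a < 1) {β Cβ τ : ℝ} (hβ0 : 0 < β) (hβ1 : β ≤ 1)
    (hC : 0 < Cβ) {c : (Fin d → Fin M) → ℝ} (hc : ∀ k, |c k| ≤ τ)
    (hτ : 2 * τ ≤ Cβ * ((1 - a) / M) ^ β) :
    ∃ g ∈ HolderClass d β Cβ, ∀ x ∈ grid d M a, g x = 1 / 2 + stepFn a c x := by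
  refine exists_mem_holderClass_eqOn (B := 1 / 2 + τ) hβ0 hβ1 hC (fun x hx => ?_)
    fun x hx y hy => ?_
  · obtain ⟨k, hk⟩ := mem_grid_iff.1 hx
    rw [stepFn_of_mem ha c hk]
    refine (abs_add_le _ _).trans ?_
    rw [abs_of_pos one_half_pos]
    gcongr
    exact hc k
  · obtain ⟨k, hk⟩ := mem_grid_iff.1 hx
    obtain ⟨l, hl⟩ := mem_grid_iff.1 hy
    rw [stepFn_of_mem ha c hk, stepFn_of_mem ha c hl, add_sub_add_left_eq_sub]
    by_cases hkl : k = l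
    · rw [hkl, sub_self, abs_zero]
      positivity
    · have hgap : ((1 - a) / M) ^ β ≤ ‖x - y‖ ^ β :=
        Real.rpow_le_rpow (div_nonneg (by linarith) (Nat.cast_nonneg M)) (cell_gap hkl hk hl)
          hβ0.le
      calc |c k - c l| ≤ |c k| + |c l| := abs_sub _ _
        _ ≤ 2 * τ := by linarith [hc k, hc l]
        _ ≤ Cβ * ((1 - a) / M) ^ β := hτ
        _ ≤ Cβ * ‖x - y‖ ^ β := by gcongr

end StepFn

/-! ### Averaging over sign vectors -/

section Assouad

variable {d M : ℕ} {a : ℝ}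

/-- The law of the data when both regression functions are step functions plus `1 / 2`. -/
def stepSampleLaw (a : ℝ) (nP nQ : ℕ) (cP cQ : (Fin d → Fin M) → ℝ) : Measure (Sample d nP nQ) :=
  (Measure.pi fun _ : Fin nP => labelledMeasure (gridLaw d M a) (stepFn a cP)).prod
    (Measure.pi fun _ : Fin nQ => labelledMeasure (gridLaw d M a) (stepFn a cQ))

/-- The contribution of a cell to the excess risk if the value of `η - 1 / 2` there is `v`. -/
def cellLoss (a : ℝ) (k : Fin d → Fin M) (v : ℝ) (f : Cov d → Fin 2) : ENNReal :=
  ∫⁻ x in cell a k, ENNReal.ofReal (|v| - v * labelSign (f x)) ∂gridLaw d M a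

lemma abs_sub_mul_labelSign_nonneg (v : ℝ) (y : Fin 2) : 0 ≤ |v| - v * labelSign y := by
  have : |v * labelSign y| = |v| := by rw [abs_mul, abs_labelSign, mul_one]
  linarith [le_abs_self (v * labelSign y)]

/-- The cells are disjoint and the loss is nonnegative, so discarding everything outside `A` only
lowers the risk. Each remaining term involves the regression function only through its value on that
cell. -/
lemma sum_cellLoss_le_excessRisk [IsProbabilityMeasure (gridLaw d M a)] (ha : a < 1)
    {c : (Fin d → Fin M) → ℝ} (hc : ∀ x, |stepFn a c x| ≤ 1 / 2) (A : Finset (Fin d → Fin M))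
    {f : Cov d → Fin 2} (hf : Measurable f) :
    ∑ k ∈ A, cellLoss a k (c k) f ≤
      ENNReal.ofReal (excessRisk (labelled (gridLaw d M a) (stepFn a c) (measurable_stepFn c) hc)
        f) := by
  have hm : Measurable (stepFn a c) := measurable_stepFn c
  have hint : Integrable (fun x => |stepFn a c x| - stepFn a c x * labelSign (f x))
      (gridLaw d M a) := by
    refine (integrable_of_abs_le hm hc).abs.sub
      (integrable_of_abs_le (C := 1 / 2) (hm.mul (measurable_labelSign.comp hf)) fun x => ?_)
    rw [abs_mul, abs_labelSign, mul_one]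
    exact hc x
  rw [excessRisk_labelled hm hc hf, ofReal_integral_eq_lintegral_ofReal hint
    (ae_of_all _ fun x => abs_sub_mul_labelSign_nonneg _ _)]
  have hcell : ∀ k ∈ A, cellLoss a k (c k) f = ∫⁻ x in cell a k,
      ENNReal.ofReal (|stepFn a c x| - stepFn a c x * labelSign (f x)) ∂gridLaw d M a := by
    intro k _
    refine setLIntegral_congr_fun (measurableSet_cell a k) fun x hx => ?_
    simp only [stepFn_of_mem ha c hx]
  rw [Finset.sum_congr rfl hcell, ← lintegral_biUnion_finset]
  · exact setLIntegral_le_lintegral _ _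
  · intro k _ l _ hkl
    exact Set.disjoint_left.2 fun x hx hy => hkl (cell_unique ha hx hy)
  · exact fun k _ => measurableSet_cell a k

/-- At every point a label is wrong for exactly one of the two signs and then costs `2 τ`. The sum
does not depend on the classifier, which makes it the separation in the two point bound. -/
lemma cellLoss_add_cellLoss_neg (k : Fin d → Fin M) {τ : ℝ} (hτ : 0 ≤ τ) {f : Cov d → Fin 2}
    (hf : Measurable f) :
    cellLoss a k τ f + cellLoss a k (-τ) f = ENNReal.ofReal (2 * τ) * gridLaw d M a (cell a k) := by
  have hm : Measurable fun x => ENNReal.ofReal (|τ| - τ * labelSign (f x)) :=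
    (((measurable_labelSign.comp hf).const_mul τ).const_sub _).ennreal_ofReal
  rw [cellLoss, cellLoss, ← lintegral_add_left hm, ← setLIntegral_const]
  refine lintegral_congr fun x => ?_
  rw [← ENNReal.ofReal_add (abs_sub_mul_labelSign_nonneg _ _) (abs_sub_mul_labelSign_nonneg _ _),
    abs_neg, abs_of_nonneg hτ]
  congr 1
  ring

lemma measurable_cellLoss [IsProbabilityMeasure (gridLaw d M a)] {nP nQ : ℕ}
    (f : Classifier d nP nQ) (k : Fin d → Fin M) (v : ℝ) :
    Measurable fun z => cellLoss a k v (f.1 z) := by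
  have hm : Measurable fun p : Sample d nP nQ × Cov d =>
      ENNReal.ofReal (|v| - v * labelSign (f.1 p.1 p.2)) :=
    (((measurable_labelSign.comp f.2).const_mul v).const_sub _).ennreal_ofReal
  exact hm.lintegral_prod_right'

/-- The two point bound for the values `τ` and `-τ` on one cell. -/
lemma cell_two_point_bound [IsProbabilityMeasure (gridLaw d M a)] (hM : 0 < M) (ha0 : 0 < a)
    (ha : a < 1) {nP nQ : ℕ} (f : Classifier d nP nQ) (k : Fin d → Fin M) {τP τQ : ℝ}
    (hP0 : 0 ≤ τP) (hP1 : τP ≤ 1 / 2) (hQ0 : 0 ≤ τQ) (hQ1 : τQ ≤ 1 / 2)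
    (h : nP * (4 * (τP ^ 2 * ((M : ℝ) ^ d)⁻¹)) + nQ * (4 * (τQ ^ 2 * ((M : ℝ) ^ d)⁻¹)) ≤ 1 / 5)
    {cP cQ : (Fin d → Fin M) → ℝ} (hcP : ∀ l, |cP l| ≤ 1 / 2) (hcQ : ∀ l, |cQ l| ≤ 1 / 2)
    (hkP : cP k = 0) (hkQ : cQ k = 0) :
    ENNReal.ofReal τQ * gridLaw d M a (cell a k) ≤
      ∫⁻ z, cellLoss a k τQ (f.1 z)
          ∂stepSampleLaw a nP nQ (cP + Pi.single k τP) (cQ + Pi.single k τQ) +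
        ∫⁻ z, cellLoss a k (-τQ) (f.1 z)
          ∂stepSampleLaw a nP nQ (cP + Pi.single k (-τP)) (cQ + Pi.single k (-τQ)) := by
  have hmul : ∀ {c : (Fin d → Fin M) → ℝ} (τ : ℝ), c k = 0 → ∀ x,
      stepFn a c x * stepFn a (Pi.single k τ) x = 0 := fun {c} τ hk x => by
    refine stepFn_mul_eq_zero ha (fun l => ?_) x
    by_cases hl : l = k
    · rw [hl, hk, zero_mul]
    · rw [Pi.single_eq_of_ne hl, mul_zero]
  have hsingle : ∀ {τ : ℝ}, 0 ≤ τ → τ ≤ 1 / 2 → ∀ x : Cov d,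
      |stepFn a (Pi.single k τ) x| ≤ 1 / 2 := fun {τ} h0 h1 x => by
    rw [stepFn_single]
    by_cases hx : x ∈ cell a k
    · rw [Set.indicator_of_mem hx, abs_of_nonneg h0]; exact h1
    · rw [Set.indicator_of_notMem hx, abs_zero]; norm_num
  have hneg : ∀ τ : ℝ, ∀ x : Cov d,
      stepFn a (Pi.single k (-τ)) x = -stepFn a (Pi.single k τ) x := fun τ x => by
    rw [stepFn_single, stepFn_single]
    by_cases hx : x ∈ cell a k <;> simp [hx]
  have hplus : ∀ {c : (Fin d → Fin M) → ℝ} (τ : ℝ), (∀ l, |c l| ≤ 1 / 2) → c k = 0 →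
      labelledMeasure (gridLaw d M a) (stepFn a (c + Pi.single k τ)) =
        (labelledMeasure (gridLaw d M a) (stepFn a c)).withDensity fun z =>
          ENNReal.ofReal (1 + 2 * stepFn a (Pi.single k τ) z.1 * labelSign z.2) :=
    fun {c} τ hc hk => by
      rw [← labelledMeasure_add (measurable_stepFn c) (measurable_stepFn _)
        (abs_stepFn_le ha (by norm_num) hc) (hmul τ hk)]
      congr 1
      ext x
      exact stepFn_add _ _ x
  have hminus : ∀ {c : (Fin d → Fin M) → ℝ} (τ : ℝ), (∀ l, |c l| ≤ 1 / 2) → c k = 0 →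
      labelledMeasure (gridLaw d M a) (stepFn a (c + Pi.single k (-τ))) =
        (labelledMeasure (gridLaw d M a) (stepFn a c)).withDensity fun z =>
          ENNReal.ofReal (1 + -(2 * stepFn a (Pi.single k τ) z.1 * labelSign z.2)) :=
    fun {c} τ hc hk => by
      rw [hplus (-τ) hc hk]
      congr 1
      ext z
      rw [hneg]
      ring_nf
  have hsP := abs_stepFn_le ha (by norm_num) hcP
  have hsQ := abs_stepFn_le ha (by norm_num) hcQ
  have := isProbabilityMeasure_labelledMeasure (U := gridLaw d M a) (measurable_stepFn cP) hsP
  have := isProbabilityMeasure_labelledMeasure (U := gridLaw d M a) (measurable_stepFn cQ) hsQ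
  have hu : ∀ τ : ℝ, Measurable fun z : Obs d =>
      2 * stepFn a (Pi.single k τ) z.1 * labelSign z.2 := fun τ =>
    (((measurable_stepFn _).comp measurable_fst).const_mul 2).mul
      (measurable_labelSign.comp measurable_snd)
  have hu1 : ∀ {τ : ℝ}, 0 ≤ τ → τ ≤ 1 / 2 → ∀ z : Obs d,
      |2 * stepFn a (Pi.single k τ) z.1 * labelSign z.2| ≤ 1 := fun h0 h1 z => by
    rw [abs_mul, abs_labelSign, mul_one, abs_mul, abs_two]; linarith [hsingle h0 h1 z.1]
  obtain ⟨mP, vP⟩ := integral_perturbation (U := gridLaw d M a) (measurable_stepFn cP)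
    (measurable_stepFn _) hsP (hsingle hP0 hP1) (hmul τP hkP)
  obtain ⟨mQ, vQ⟩ := integral_perturbation (U := gridLaw d M a) (measurable_stepFn cQ)
    (measurable_stepFn _) hsQ (hsingle hQ0 hQ1) (hmul τQ hkQ)
  rw [integral_stepFn_single_sq hM ha0 ha] at vP vQ
  have key := two_point_bound (m := nP) (n := nQ) (hu τP) (hu τQ) (hu1 hP0 hP1) (hu1 hQ0 hQ1)
    mP mQ (by rw [vP, vQ]; exact h) (measurable_cellLoss (a := a) f k τQ)
    (measurable_cellLoss (a := a) f k (-τQ))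
    (fun z => (cellLoss_add_cellLoss_neg (a := a) k hQ0
      (f.2.comp measurable_prodMk_left : Measurable (f.1 z))).ge)
  rw [stepSampleLaw, stepSampleLaw, hplus τP hcP hkP, hplus τQ hcQ hkQ, hminus τP hcP hkP,
    hminus τQ hcQ hkQ]
  -- The separation `2 τQ` times the affinity bound `1 / 2` leaves `τQ`.
  refine le_trans (le_of_eq ?_) key
  rw [mul_right_comm, ← ENNReal.ofReal_mul (by positivity)]
  congr 2
  ring

/-- The coefficients `τ` and `-τ` on the cells in `A`, according to the sign vector `σ`. -/
def signedCoef {ι : Type*} [DecidableEq ι] (A : Finset ι) (τ : ℝ) (σ : ι → Bool) (k : ι) : ℝ :=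
  if k ∈ A then (if σ k then τ else -τ) else 0

lemma abs_signedCoef_le {ι : Type*} [DecidableEq ι] (A : Finset ι) {τ : ℝ} (hτ : 0 ≤ τ)
    (σ : ι → Bool) (k : ι) : |signedCoef A τ σ k| ≤ τ := by
  unfold signedCoef
  split_ifs <;> simp [abs_of_nonneg hτ, hτ]

/-- Both sign choices at `k` are opposite perturbations of one baseline that vanishes on cell `k`,
the situation of `cell_two_point_bound`. -/
lemma signedCoef_update {ι : Type*} [DecidableEq ι] {A : Finset ι} (τ : ℝ) (σ : ι → Bool) {k : ι}
    (hk : k ∈ A) (b : Bool) :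
    signedCoef A τ (Function.update σ k b) =
      signedCoef (A.erase k) τ σ + Pi.single k (if b then τ else -τ) := by
  ext l
  by_cases hl : l = k
  · subst hl
    simp [signedCoef, hk]
  · simp [signedCoef, hl]

/-- Assouad's lemma for the family of step functions with signs on the cells in `A`. -/
lemma assouad_bound [IsProbabilityMeasure (gridLaw d M a)] (hM : 0 < M) (ha0 : 0 < a) (ha : a < 1)
    {nP nQ : ℕ} (f : Classifier d nP nQ) (A : Finset (Fin d → Fin M)) {τP τQ : ℝ}
    (hP0 : 0 ≤ τP) (hP1 : τP ≤ 1 / 2) (hQ0 : 0 ≤ τQ) (hQ1 : τQ ≤ 1 / 2)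
    (h : nP * (4 * (τP ^ 2 * ((M : ℝ) ^ d)⁻¹)) + nQ * (4 * (τQ ^ 2 * ((M : ℝ) ^ d)⁻¹)) ≤ 1 / 5)
    {S : ENNReal} (hS : ∀ σ : (Fin d → Fin M) → Bool,
      ∑ k ∈ A, ∫⁻ z, cellLoss a k (signedCoef A τQ σ k) (f.1 z)
        ∂stepSampleLaw a nP nQ (signedCoef A τP σ) (signedCoef A τQ σ) ≤ S) :
    A.card * (ENNReal.ofReal τQ * ENNReal.ofReal (((M : ℝ) ^ d)⁻¹)) ≤ 2 * S := by
  set e := ENNReal.ofReal τQ * ENNReal.ofReal (((M : ℝ) ^ d)⁻¹) with he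
  set T : (Fin d → Fin M) → ((Fin d → Fin M) → Bool) → ENNReal := fun k σ =>
    ∫⁻ z, cellLoss a k (signedCoef A τQ σ k) (f.1 z)
      ∂stepSampleLaw a nP nQ (signedCoef A τP σ) (signedCoef A τQ σ) with hT
  have hpair : ∀ k ∈ A, ∀ σ,
      e ≤ T k (Function.update σ k true) + T k (Function.update σ k false) := by
    intro k hk σ
    have hzero : ∀ τ, signedCoef (A.erase k) τ σ k = 0 := fun τ => by simp [signedCoef]
    have := cell_two_point_bound hM ha0 ha f k hP0 hP1 hQ0 hQ1 h
      (fun l => (abs_signedCoef_le (A.erase k) hP0 σ l).trans hP1)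
      (fun l => (abs_signedCoef_le (A.erase k) hQ0 σ l).trans hQ1) (hzero τP) (hzero τQ)
    rw [gridLaw_cell hM ha0 ha] at this
    simpa [hT, signedCoef_update _ σ hk, hzero] using this
  have hflip : ∀ k, Function.Involutive
      fun σ : (Fin d → Fin M) → Bool => Function.update σ k (!σ k) := by
    intro k σ
    simp
  have hsum : ∀ k ∈ A,
      (Fintype.card ((Fin d → Fin M) → Bool) : ENNReal) * e ≤ 2 * ∑ σ, T k σ := by
    intro k hk
    have h1 : ∑ σ, T k (Function.update σ k (!σ k)) = ∑ σ, T k σ :=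
      Equiv.sum_comp (hflip k).toPerm (T k)
    calc (Fintype.card ((Fin d → Fin M) → Bool) : ENNReal) * e
        = ∑ _σ : (Fin d → Fin M) → Bool, e := by simp
      -- Each sign vector is paired with its flip at `k`. Flipping is a bijection of the sign
      -- vectors, so both halves have the same sum.
      _ ≤ ∑ σ, (T k σ + T k (Function.update σ k (!σ k))) := by
          refine Finset.sum_le_sum fun σ _ => ?_
          have h2 := hpair k hk σ
          rcases hσ : σ k with _ | _
          · have : Function.update σ k false = σ := by rw [← hσ, Function.update_eq_self]
            rw [this] at h2
            simpa [hσ, add_comm] using h2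
          · have : Function.update σ k true = σ := by rw [← hσ, Function.update_eq_self]
            rw [this] at h2
            simpa [hσ] using h2
      _ = 2 * ∑ σ, T k σ := by rw [Finset.sum_add_distrib, h1, two_mul]
  set N : ENNReal := (Fintype.card ((Fin d → Fin M) → Bool) : ENNReal) with hN
  have hN0 : N ≠ 0 := by simp [hN]
  have hNt : N ≠ ⊤ := ENNReal.natCast_ne_top _
  -- Averaging over the sign vectors, written as multiplication by their number `N`.
  refine (ENNReal.mul_le_mul_iff_right hN0 hNt).1 ?_
  calc N * (A.card * e) = ∑ _k ∈ A, N * e := by rw [Finset.sum_const, nsmul_eq_mul]; ring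
    _ ≤ ∑ k ∈ A, 2 * ∑ σ, T k σ := Finset.sum_le_sum hsum
    _ = 2 * ∑ σ, ∑ k ∈ A, T k σ := by rw [← Finset.mul_sum, Finset.sum_comm]
    _ ≤ 2 * ∑ _σ : (Fin d → Fin M) → Bool, S := by
        gcongr with σ
        exact hS σ
    _ = N * (2 * S) := by rw [Finset.sum_const, Finset.card_univ, nsmul_eq_mul]; ring

end Assouad

/-! ### The lower bound for a grid of fixed mesh -/

section FixedGrid

variable {d M : ℕ} {a : ℝ}

lemma stepFn_signedCoef_eq_zero_or (ha : a < 1) (A : Finset (Fin d → Fin M)) {τ : ℝ} (hτ : 0 ≤ τ)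
    (σ : (Fin d → Fin M) → Bool) (x : Cov d) :
    stepFn a (signedCoef A τ σ) x = 0 ∨
      ∃ k ∈ A, x ∈ cell a k ∧ |stepFn a (signedCoef A τ σ) x| = τ := by
  by_cases hx : x ∈ grid d M a
  · obtain ⟨k, hk⟩ := mem_grid_iff.1 hx
    rw [stepFn_of_mem ha _ hk]
    by_cases hkA : k ∈ A
    · refine Or.inr ⟨k, hkA, hk, ?_⟩
      unfold signedCoef
      split_ifs <;> simp [abs_of_nonneg hτ]
    · exact Or.inl (by simp [signedCoef, hkA])
  · exact Or.inl (stepFn_of_notMem _ hx)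

lemma stepFn_signedCoef_signal (ha : a < 1) (A : Finset (Fin d → Fin M)) {τ γ Cγ : ℝ} (hτ : 0 ≤ τ)
    (hγ : 0 < γ) (hCγ : 0 ≤ Cγ) (σ : (Fin d → Fin M) → Bool) (x : Cov d) :
    0 ≤ stepFn a (signedCoef A (Cγ * τ ^ γ) σ) x * stepFn a (signedCoef A τ σ) x ∧
      Cγ * |stepFn a (signedCoef A τ σ) x| ^ γ ≤
        |stepFn a (signedCoef A (Cγ * τ ^ γ) σ) x| := by
  have hτ' : 0 ≤ Cγ * τ ^ γ := by positivity
  by_cases hx : x ∈ grid d M a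
  · obtain ⟨k, hk⟩ := mem_grid_iff.1 hx
    rw [stepFn_of_mem ha _ hk, stepFn_of_mem ha _ hk]
    unfold signedCoef
    split_ifs
    · exact ⟨by positivity, by rw [abs_of_nonneg hτ, abs_of_nonneg hτ']⟩
    · exact ⟨by rw [neg_mul_neg]; positivity,
        by rw [abs_neg, abs_neg, abs_of_nonneg hτ, abs_of_nonneg hτ']⟩
    · simp [Real.zero_rpow hγ.ne']
  · rw [stepFn_of_notMem _ hx, stepFn_of_notMem _ hx]
    simp [Real.zero_rpow hγ.ne']

/-- The pairs of distributions built from sign vectors belong to the parameter space. -/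
lemma paramSpace_labelled [IsProbabilityMeasure (gridLaw d M a)] (hd : 0 < d) (hM : 0 < M)
    (ha0 : 0 < a) (ha : a < 1) {α Cα β Cβ γ Cγ μ₁ μ₂ cμ rμ : ℝ} (hα : 0 ≤ α) (hCα : 0 < Cα)
    (hβ0 : 0 < β) (hβ1 : β ≤ 1) (hCβ : 0 < Cβ) (hγ : 0 < γ) (hCγ : 0 ≤ Cγ)
    (hμ₁ : 0 < μ₁) (h1 : μ₁ < (a ^ d)⁻¹) (h2 : (a ^ d)⁻¹ < μ₂)
    (hc : cμ ≤ gridRegularity d a (max rμ 1)) (A : Finset (Fin d → Fin M)) {τ : ℝ} (hτ : 0 ≤ τ)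
    (hHolder : 2 * τ ≤ Cβ * ((1 - a) / M) ^ β)
    (hmargin : A.card * ((M : ℝ) ^ d)⁻¹ ≤ Cα * τ ^ α) (σ : (Fin d → Fin M) → Bool)
    (hP : ∀ x, |stepFn a (signedCoef A (Cγ * τ ^ γ) σ) x| ≤ 1 / 2)
    (hQ : ∀ x, |stepFn a (signedCoef A τ σ) x| ≤ 1 / 2) :
    ParamSpace α Cα β Cβ γ Cγ μ₁ μ₂ cμ rμ
      (labelled (gridLaw d M a) _ (measurable_stepFn (signedCoef A (Cγ * τ ^ γ) σ)) hP)
      (labelled (gridLaw d M a) _ (measurable_stepFn (signedCoef A τ σ)) hQ) := by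
  have heP := eta_labelled (U := gridLaw d M a) (measurable_stepFn _) hP
  have heQ := eta_labelled (U := gridLaw d M a) (measurable_stepFn _) hQ
  have hmP := marginal_labelled (U := gridLaw d M a) (measurable_stepFn _) hP
  have hmQ := marginal_labelled (U := gridLaw d M a) (measurable_stepFn _) hQ
  have hcube : ∀ᵐ x ∂gridLaw d M a, x ∈ unitCube d :=
    ae_mem_grid.mono fun x hx => grid_subset_unitCube ha.le hx
  refine ⟨by rw [hmP]; exact hcube, by rw [hmQ]; exact hcube, ?_, ?_, ?_,
    strongDensity_of_marginal hd hM ha0 ha hμ₁ h1 h2 hc hmP hmQ⟩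
  · rw [RelativeSignalExponent, hmP, hmQ, ae_add_measure_iff, and_self]
    filter_upwards [heP, heQ] with x hx hx'
    rw [hx, hx', add_sub_cancel_left, add_sub_cancel_left]
    exact stepFn_signedCoef_signal ha A hτ hγ hCγ σ x
  · intro t ht
    rw [hmQ]
    -- `|η_Q - 1/2|` takes only the values `0` and `τ` almost everywhere: for `t ≤ τ` the margin
    -- event is null, and for `t > τ` it lies in the cells of `A` up to a null set.
    rcases le_or_gt t τ with htτ | htτ
    · refine le_trans (le_of_eq ?_) (by positivity : 0 ≤ Cα * t ^ α)
      rw [measureReal_def, measure_eq_zero_iff_ae_notMem.2, ENNReal.toReal_zero]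
      filter_upwards [heQ] with x hx
      rintro ⟨hx1, hx2⟩
      rw [hx, add_sub_cancel_left] at hx1 hx2
      rcases stepFn_signedCoef_eq_zero_or ha A hτ σ x with h | ⟨k, -, -, h⟩
      · rw [h, abs_zero] at hx1; exact lt_irrefl _ hx1
      · rw [h] at hx2; linarith
    · have hle : gridLaw d M a {x | 0 < |eta (labelled (gridLaw d M a) _
          (measurable_stepFn (signedCoef A τ σ)) hQ) x - 1 / 2| ∧
          |eta (labelled (gridLaw d M a) _ (measurable_stepFn (signedCoef A τ σ)) hQ) x - 1 / 2| <
            t} ≤ ENNReal.ofReal (A.card * ((M : ℝ) ^ d)⁻¹) := by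
        calc _ ≤ gridLaw d M a (⋃ k ∈ A, cell a k) := by
              refine measure_mono_ae ?_
              filter_upwards [heQ] with x hx
              rintro ⟨hx1, -⟩
              rw [hx, add_sub_cancel_left] at hx1
              rcases stepFn_signedCoef_eq_zero_or ha A hτ σ x with h | ⟨k, hk, hxk, -⟩
              · rw [h, abs_zero] at hx1; exact absurd hx1 (lt_irrefl _)
              · exact Set.mem_biUnion hk hxk
          _ ≤ ∑ k ∈ A, gridLaw d M a (cell a k) := measure_biUnion_finset_le _ _
          _ = ENNReal.ofReal (A.card * ((M : ℝ) ^ d)⁻¹) := by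
              simp_rw [gridLaw_cell hM ha0 ha]
              rw [Finset.sum_const, nsmul_eq_mul, ENNReal.ofReal_mul (by positivity),
                ENNReal.ofReal_natCast]
      calc _ ≤ A.card * ((M : ℝ) ^ d)⁻¹ := ENNReal.toReal_le_of_le_ofReal (by positivity) hle
        _ ≤ Cα * τ ^ α := hmargin
        _ ≤ Cα * t ^ α := by gcongr
  · obtain ⟨g, hg, hgx⟩ := exists_holder_extension (d := d) ha hβ0 hβ1 hCβ
      (fun k => abs_signedCoef_le A hτ σ k) hHolder
    refine ⟨g, hg, ?_⟩
    rw [hmQ]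
    filter_upwards [heQ, ae_mem_grid] with x hx hx'
    rw [hx, hgx x hx']

/-- The minimax lower bound that a set `A` of cells with signals of size `τ` yields. -/
lemma le_minimaxRisk (hd : 0 < d) (hM : 0 < M) (ha0 : 0 < a) (ha : a < 1)
    {α Cα β Cβ γ Cγ μ₁ μ₂ cμ rμ : ℝ} (hα : 0 ≤ α) (hCα : 0 < Cα)
    (hβ0 : 0 < β) (hβ1 : β ≤ 1) (hCβ : 0 < Cβ) (hγ : 0 < γ) (hCγ : 0 ≤ Cγ)
    (hμ₁ : 0 < μ₁) (h1 : μ₁ < (a ^ d)⁻¹) (h2 : (a ^ d)⁻¹ < μ₂)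
    (hc : cμ ≤ gridRegularity d a (max rμ 1)) (A : Finset (Fin d → Fin M)) {τ : ℝ} (hτ : 0 ≤ τ)
    (hHolder : 2 * τ ≤ Cβ * ((1 - a) / M) ^ β)
    (hmargin : A.card * ((M : ℝ) ^ d)⁻¹ ≤ Cα * τ ^ α) (hQ : τ ≤ 1 / 2)
    (hP : Cγ * τ ^ γ ≤ 1 / 2) {nP nQ : ℕ}
    (h : nP * (4 * ((Cγ * τ ^ γ) ^ 2 * ((M : ℝ) ^ d)⁻¹)) +
      nQ * (4 * (τ ^ 2 * ((M : ℝ) ^ d)⁻¹)) ≤ 1 / 5) :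
    ENNReal.ofReal (A.card * (τ * ((M : ℝ) ^ d)⁻¹) / 2) ≤
      minimaxRisk d nP nQ α Cα β Cβ γ Cγ μ₁ μ₂ cμ rμ := by
  have := isProbabilityMeasure_gridLaw (d := d) hM ha0 ha
  have hτ' : 0 ≤ Cγ * τ ^ γ := by positivity
  refine le_iInf fun f => ?_
  set S := ⨆ (P : ProbabilityMeasure (Obs d)) (Q : ProbabilityMeasure (Obs d))
      (_ : ParamSpace α Cα β Cβ γ Cγ μ₁ μ₂ cμ rμ P Q), expectedExcessRisk P Q f with hS
  have key := assouad_bound hM ha0 ha f A hτ' hP hτ hQ h (S := S) fun σ => by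
    have hP' : ∀ x : Cov d, |stepFn a (signedCoef A (Cγ * τ ^ γ) σ) x| ≤ 1 / 2 :=
      abs_stepFn_le ha (by norm_num) fun k => (abs_signedCoef_le A hτ' σ k).trans hP
    have hQ' : ∀ x : Cov d, |stepFn a (signedCoef A τ σ) x| ≤ 1 / 2 :=
      abs_stepFn_le ha (by norm_num) fun k => (abs_signedCoef_le A hτ σ k).trans hQ
    have hmem := paramSpace_labelled hd hM ha0 ha hα hCα hβ0 hβ1 hCβ hγ hCγ hμ₁ h1 h2 hc A hτ
      hHolder hmargin σ hP' hQ'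
    refine le_trans ?_ (le_iSup_of_le _ (le_iSup_of_le _ (le_iSup_of_le hmem le_rfl)))
    rw [expectedExcessRisk, ← lintegral_finsetSum _ fun k _ => measurable_cellLoss f k _]
    exact lintegral_mono fun z => sum_cellLoss_le_excessRisk ha hQ' A
      (f.2.comp measurable_prodMk_left : Measurable (f.1 z))
  have hcard : ENNReal.ofReal (A.card * (τ * ((M : ℝ) ^ d)⁻¹) / 2) * 2 =
      A.card * (ENNReal.ofReal τ * ENNReal.ofReal (((M : ℝ) ^ d)⁻¹)) := by
    rw [← ENNReal.ofReal_mul hτ, ← ENNReal.ofReal_natCast, ← ENNReal.ofReal_mul (by positivity),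
      ← ENNReal.ofReal_ofNat, ← ENNReal.ofReal_mul (by positivity)]
    congr 1
    ring
  rw [← hcard, mul_comm] at key
  exact (ENNReal.mul_le_mul_iff_right two_ne_zero ENNReal.ofNat_ne_top).1 key

end FixedGrid

/-! ### The choice of the mesh -/

/-- The density `w` is chosen above 1 as well as between the two bounds, so that `a = w ^ (-1/d)` is
less than 1 and the cells have gaps. -/
lemma exists_tooth_ratio {d : ℕ} (hd : 0 < d) {μ₁ μ₂ : ℝ} (hμ : μ₁ < μ₂)
    (hμ₂ : 1 < μ₂) : ∃ a : ℝ, 0 < a ∧ a < 1 ∧ μ₁ < (a ^ d)⁻¹ ∧ (a ^ d)⁻¹ < μ₂ := by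
  obtain ⟨w, hw1, hw2⟩ := exists_between (max_lt hμ hμ₂)
  have hw0 : 0 < w := lt_trans one_pos ((le_max_right _ _).trans_lt hw1)
  have hwd : ((w⁻¹ ^ ((d : ℝ)⁻¹)) ^ d)⁻¹ = w := by
    rw [Real.rpow_inv_natCast_pow (by positivity) hd.ne', inv_inv]
  refine ⟨w⁻¹ ^ ((d : ℝ)⁻¹), by positivity, ?_, ?_, ?_⟩
  · exact Real.rpow_lt_one (by positivity)
      (inv_lt_one_of_one_lt₀ ((le_max_right _ _).trans_lt hw1)) (by positivity)
  · rw [hwd]; exact (le_max_left _ _).trans_lt hw1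
  · rw [hwd]; exact hw2

/-- All conditions on the mesh hold once it is fine enough. -/
lemma exists_mesh_bound {α β γ Cγ L κ D : ℝ} (hβ : 0 < β) (hγ : 0 < γ) (hκ : 0 < κ)
    (hαβ : α * β < D ∨ (α * β = D ∧ κ = 1)) (B : ℝ) :
    ∃ K : ℝ, 1 ≤ K ∧ B ≤ K ∧ ∀ x : ℝ, K ≤ x →
      L * x ^ (-β) ≤ 1 / 2 ∧ Cγ * (L * x ^ (-β)) ^ γ ≤ 1 / 2 ∧ 1 ≤ κ * x ^ (D - α * β) := by
  have hlim : Filter.Tendsto (fun x : ℝ => L * x ^ (-β)) Filter.atTop (nhds 0) := by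
    simpa using (tendsto_rpow_neg_atTop hβ).const_mul L
  have hlim2 : Filter.Tendsto (fun x : ℝ => Cγ * (L * x ^ (-β)) ^ γ) Filter.atTop (nhds 0) := by
    have := (hlim.rpow_const (p := γ) (Or.inr hγ.le)).const_mul Cγ
    simpa [Real.zero_rpow hγ.ne'] using this
  have h1 := hlim.eventually_le_const (show (0 : ℝ) < 1 / 2 by norm_num)
  have h2 := hlim2.eventually_le_const (show (0 : ℝ) < 1 / 2 by norm_num)
  -- In the boundary case the power is `x ^ 0 = 1`, so `κ = 1` is exactly enough for one cell.
  have h3 : ∀ᶠ x : ℝ in Filter.atTop, 1 ≤ κ * x ^ (D - α * β) := by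
    rcases hαβ with h | ⟨h, rfl⟩
    · exact ((tendsto_rpow_atTop (sub_pos.2 h)).const_mul_atTop hκ).eventually_ge_atTop 1
    · simp [h]
  obtain ⟨K, hK⟩ := Filter.eventually_atTop.1 (h1.and (h2.and h3))
  refine ⟨max K (max 1 B), (le_max_left _ _).trans (le_max_right _ _),
    (le_max_right _ _).trans (le_max_right _ _), fun x hx => hK x ((le_max_left _ _).trans hx)⟩

/-- If `n ≤ x ^ p` then `n M ^ (-p)` is small for a multiple `M` of `x`. -/
lemma mul_rpow_neg_le_inv {n x K y p : ℝ} (hK : 1 ≤ K) (hx : 1 ≤ x) (hp : 1 ≤ p)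
    (hn : n ≤ x ^ p) (hy : K * x ≤ y) : n * y ^ (-p) ≤ K⁻¹ := by
  have hKx : 0 < K * x := by positivity
  have hy0 : 0 < y := hKx.trans_le hy
  rw [Real.rpow_neg hy0.le, ← div_eq_mul_inv, div_le_iff₀ (by positivity), inv_mul_eq_div,
    le_div_iff₀ (by positivity)]
  calc n * K ≤ x ^ p * K ^ p := by
        gcongr
        simpa using Real.rpow_le_rpow_of_exponent_le hK hp
    _ = (K * x) ^ p := by rw [mul_comm, Real.mul_rpow (by positivity) (by positivity)]
    _ ≤ y ^ p := by gcongr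

/-- The lower bound for a fixed tooth ratio `a` of the grid. -/
lemma rate_le_minimaxRisk {d : ℕ} (hd : 0 < d) {a : ℝ} (ha0 : 0 < a) (ha : a < 1)
    {α Cα β Cβ γ Cγ μ₁ μ₂ cμ rμ : ℝ} (hα : 0 ≤ α) (hCα : 0 < Cα)
    (hβ0 : 0 < β) (hβ1 : β ≤ 1) (hCβ : 0 < Cβ) (hγ : 0 < γ) (hCγ : 0 < Cγ)
    (hμ₁ : 0 < μ₁) (h1 : μ₁ < (a ^ d)⁻¹) (h2 : (a ^ d)⁻¹ < μ₂)
    (hc : cμ ≤ gridRegularity d a (max rμ 1))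
    (hαβ : α * β < d ∨ (α * β = d ∧ (Cβ * (1 - a) / 2) ^ (-α) ≤ Cα)) :
    ∃ c : ℝ, 0 < c ∧ ∀ nP nQ : ℕ, 0 < nP + nQ →
      ENNReal.ofReal (c * ((nP : ℝ) ^ ((2 * β + d) / (2 * γ * β + d)) + (nQ : ℝ)) ^
          (-(β * (1 + α) / (2 * β + d)))) ≤
        minimaxRisk d nP nQ α Cα β Cβ γ Cγ μ₁ μ₂ cμ rμ := by
  have hd1 : (1 : ℝ) ≤ d := by exact_mod_cast hd
  -- With `τ = L M ^ (-β)` the jump `2 τ` equals `Cβ (1 - a) M ^ (-β)`, which is allowed because `1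
  -- - a ≤ (1 - a) ^ β`. Using `1 - a` without the exponent keeps the threshold `L ^ (-α)` for `Cα`
  -- free of `β`.
  set L : ℝ := Cβ * (1 - a) / 2 with hL
  have hL0 : 0 < L := by have := sub_pos.2 ha; positivity
  -- The first entry serves the margin condition, the second keeps the number of chosen cells at
  -- most `M ^ d`.
  set κ : ℝ := min (Cα * L ^ α) 1 with hκ
  have hκ0 : 0 < κ := lt_min (by positivity) one_pos
  have hαβ' : α * β < d ∨ (α * β = d ∧ κ = 1) := by
    refine hαβ.imp_right fun ⟨h, h'⟩ => ⟨h, min_eq_right ?_⟩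
    rwa [Real.rpow_neg hL0.le, inv_le_iff_one_le_mul₀ (by positivity)] at h'
  -- The lower bound on `K` is what makes the total information `4 (⋯) / K` at most `1 / 5`.
  obtain ⟨K, hK1, hKB, hK⟩ := exists_mesh_bound (L := L) (Cγ := Cγ) hβ0 hγ hκ0 hαβ'
    (20 * ((Cγ * L ^ γ) ^ 2 + L ^ 2))
  -- One factor `1/2` is lost to the integer part in `m`, one comes from `le_minimaxRisk`, and `2 K`
  -- from `M ≤ 2 K x`.
  refine ⟨κ * L / 4 * (2 * K) ^ (-(β * (1 + α))), by positivity, fun nP nQ hn => ?_⟩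
  set N : ℝ := (nP : ℝ) ^ ((2 * β + d) / (2 * γ * β + d)) + (nQ : ℝ) with hN
  have hN1 : 1 ≤ N := by
    rcases Nat.eq_zero_or_pos nP with h0 | h0
    · have : (1 : ℝ) ≤ nQ := by exact_mod_cast (by omega : 1 ≤ nQ)
      have : (0 : ℝ) ≤ (nP : ℝ) ^ ((2 * β + d) / (2 * γ * β + d)) := by positivity
      linarith
    · have : 1 ≤ (nP : ℝ) ^ ((2 * β + d) / (2 * γ * β + d)) :=
        Real.one_le_rpow (by exact_mod_cast h0) (by positivity)
      have : (0 : ℝ) ≤ nQ := by positivity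
      linarith
  set x : ℝ := N ^ ((2 * β + d)⁻¹) with hx
  have hx1 : 1 ≤ x := Real.one_le_rpow hN1 (by positivity)
  have hxp : ∀ p : ℝ, x ^ p = N ^ (p / (2 * β + d)) := fun p => by
    rw [hx, ← Real.rpow_mul (by linarith), inv_mul_eq_div]
  set M : ℕ := ⌈K * x⌉₊ with hMdef
  have hKx1 : 1 ≤ K * x := one_le_mul_of_one_le_of_one_le hK1 hx1
  have hMlow : K * x ≤ M := Nat.le_ceil _
  have hMup : (M : ℝ) ≤ 2 * K * x := by
    have := Nat.ceil_lt_add_one (show 0 ≤ K * x by linarith)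
    rw [← hMdef] at this
    linarith
  have hM1 : (1 : ℝ) ≤ M := hKx1.trans hMlow
  have hM0 : (0 : ℝ) < M := by linarith
  have hM : 0 < M := by exact_mod_cast hM0
  have hKM : K ≤ M := le_trans (le_mul_of_one_le_right (by linarith) hx1) hMlow
  obtain ⟨hτ, hτ', hm1⟩ := hK M hKM
  set τ : ℝ := L * (M : ℝ) ^ (-β) with hτdef
  have hτ0 : 0 < τ := by positivity
  have hMd : ((M : ℝ) ^ d)⁻¹ = (M : ℝ) ^ (-(d : ℝ)) := by
    rw [Real.rpow_neg hM0.le, Real.rpow_natCast]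
  set m : ℕ := ⌊κ * (M : ℝ) ^ (d - α * β)⌋₊ with hm
  have hmup : (m : ℝ) ≤ κ * (M : ℝ) ^ (d - α * β) := Nat.floor_le (by positivity)
  -- The number under the integer part is at least 1, so rounding down loses at most half of it.
  have hmlow : κ * (M : ℝ) ^ (d - α * β) / 2 ≤ m := by
    have h3 := Nat.lt_floor_add_one (κ * (M : ℝ) ^ (d - α * β))
    have h4 : (1 : ℝ) ≤ m := by exact_mod_cast (Nat.one_le_floor_iff _).2 hm1
    rw [← hm] at h3
    linarith
  have hmM : m ≤ M ^ d := by
    have : (m : ℝ) ≤ (M : ℝ) ^ d := by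
      refine hmup.trans ?_
      calc κ * (M : ℝ) ^ (d - α * β) ≤ 1 * (M : ℝ) ^ (d : ℝ) := by
            gcongr
            · exact min_le_right _ _
            · have : 0 ≤ α * β := by positivity
              linarith
        _ = (M : ℝ) ^ d := by rw [one_mul, Real.rpow_natCast]
    exact_mod_cast this
  obtain ⟨A, -, hA⟩ := Finset.exists_subset_card_eq
    (s := (Finset.univ : Finset (Fin d → Fin M))) (n := m) (by simpa using hmM)
  have hHolder : 2 * τ ≤ Cβ * ((1 - a) / M) ^ β := by
    rw [Real.div_rpow (by linarith) hM0.le, hτdef, hL, Real.rpow_neg hM0.le]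
    have h3 : 1 - a ≤ (1 - a) ^ β := by
      simpa using Real.rpow_le_rpow_of_exponent_ge (sub_pos.2 ha) (by linarith) hβ1
    calc 2 * (Cβ * (1 - a) / 2 * ((M : ℝ) ^ β)⁻¹) = Cβ * ((1 - a) / (M : ℝ) ^ β) := by ring
      _ ≤ Cβ * ((1 - a) ^ β / (M : ℝ) ^ β) := by gcongr
  have hmargin : A.card * ((M : ℝ) ^ d)⁻¹ ≤ Cα * τ ^ α := by
    rw [hA, hMd, hτdef, Real.mul_rpow hL0.le (by positivity), ← Real.rpow_mul hM0.le]
    calc (m : ℝ) * (M : ℝ) ^ (-(d : ℝ))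
        ≤ κ * (M : ℝ) ^ (d - α * β) * (M : ℝ) ^ (-(d : ℝ)) := by gcongr
      _ = κ * (M : ℝ) ^ (-β * α) := by
          rw [mul_assoc, ← Real.rpow_add hM0]
          congr 2
          ring
      _ ≤ Cα * L ^ α * (M : ℝ) ^ (-β * α) := by
          gcongr
          exact min_le_left _ _
      _ = Cα * (L ^ α * (M : ℝ) ^ (-β * α)) := by ring
  have hQrate : nQ * (M : ℝ) ^ (-(2 * β + d)) ≤ K⁻¹ := by
    refine mul_rpow_neg_le_inv hK1 hx1 (by linarith) ?_ hMlow
    rw [hxp, div_self (by positivity), Real.rpow_one, hN]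
    exact le_add_of_nonneg_left (by positivity)
  have hPrate : nP * (M : ℝ) ^ (-(2 * γ * β + d)) ≤ K⁻¹ := by
    have hγβ : 0 < γ * β := by positivity
    refine mul_rpow_neg_le_inv hK1 hx1 (by linarith) ?_ hMlow
    rw [hxp]
    -- The exponent of `nP` in `N` is such that `x ^ (2γβ + d)` dominates `nP`, just as `x ^ (2β +
    -- d) = N` dominates `nQ`.
    calc (nP : ℝ) = ((nP : ℝ) ^ ((2 * β + d) / (2 * γ * β + d))) ^
          ((2 * γ * β + d) / (2 * β + d)) := by
          rw [← Real.rpow_mul (by positivity), div_mul_div_cancel₀ (by positivity),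
            div_self (by positivity), Real.rpow_one]
      _ ≤ N ^ ((2 * γ * β + d) / (2 * β + d)) := by
          gcongr
          exact le_add_of_nonneg_right (by positivity)
  have hτsq : τ ^ 2 * ((M : ℝ) ^ d)⁻¹ = L ^ 2 * (M : ℝ) ^ (-(2 * β + d)) := by
    rw [hτdef, hMd, mul_pow, ← Real.rpow_mul_natCast hM0.le, mul_assoc, ← Real.rpow_add hM0]
    congr 2
    push_cast
    ring
  have hτ'sq : (Cγ * τ ^ γ) ^ 2 * ((M : ℝ) ^ d)⁻¹ =
      (Cγ * L ^ γ) ^ 2 * (M : ℝ) ^ (-(2 * γ * β + d)) := by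
    rw [hτdef, hMd, Real.mul_rpow hL0.le (by positivity), ← Real.rpow_mul hM0.le, ← mul_assoc,
      mul_pow _ ((M : ℝ) ^ (-β * γ)), ← Real.rpow_mul_natCast hM0.le, mul_assoc,
      ← Real.rpow_add hM0]
    congr 2
    push_cast
    ring
  have hsmall : nP * (4 * ((Cγ * τ ^ γ) ^ 2 * ((M : ℝ) ^ d)⁻¹)) +
      nQ * (4 * (τ ^ 2 * ((M : ℝ) ^ d)⁻¹)) ≤ 1 / 5 := by
    rw [hτsq, hτ'sq]
    calc _ = 4 * ((Cγ * L ^ γ) ^ 2 * (nP * (M : ℝ) ^ (-(2 * γ * β + d))) +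
          L ^ 2 * (nQ * (M : ℝ) ^ (-(2 * β + d)))) := by ring
      _ ≤ 4 * ((Cγ * L ^ γ) ^ 2 * K⁻¹ + L ^ 2 * K⁻¹) := by gcongr
      _ = 4 * ((Cγ * L ^ γ) ^ 2 + L ^ 2) / K := by ring
      _ ≤ 1 / 5 := by
          rw [div_le_iff₀ (by linarith)]
          linarith
  refine le_trans (ENNReal.ofReal_le_ofReal ?_) (le_minimaxRisk hd hM ha0 ha hα hCα hβ0 hβ1 hCβ hγ
    hCγ.le hμ₁ h1 h2 hc A hτ0.le hHolder hmargin hτ hτ' hsmall)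
  calc κ * L / 4 * (2 * K) ^ (-(β * (1 + α))) * N ^ (-(β * (1 + α) / (2 * β + d)))
      = κ * L / 4 * (2 * K * x) ^ (-(β * (1 + α))) := by
        rw [mul_assoc, Real.mul_rpow (x := 2 * K) (by positivity) (by positivity), hxp, neg_div]
    _ ≤ κ * L / 4 * (M : ℝ) ^ (-(β * (1 + α))) := by
        refine mul_le_mul_of_nonneg_left ?_ (by positivity)
        exact Real.rpow_le_rpow_of_nonpos hM0 hMup (neg_nonpos.2 (by positivity))
    _ = κ * (M : ℝ) ^ (d - α * β) / 2 * (τ * ((M : ℝ) ^ d)⁻¹) / 2 := by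
        have h3 : (M : ℝ) ^ (-(β * (1 + α))) =
            (M : ℝ) ^ (d - α * β) * (M : ℝ) ^ (-β) * (M : ℝ) ^ (-(d : ℝ)) := by
          rw [← Real.rpow_add hM0, ← Real.rpow_add hM0]
          congr 1
          ring
        rw [h3, hτdef, hMd]
        ring
    _ ≤ A.card * (τ * ((M : ℝ) ^ d)⁻¹) / 2 := by
        rw [hA]
        gcongr

end PosteriorDrift

end

/-- The tooth ratio `a` depends only on `d`, `μ₁` and `μ₂`, and the regularity constant on `rμ`
besides, so both thresholds are fixed before the other parameters. The scale `max rμ 1` meets the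
requirement `1 ≤ R` of `grid_regular`. -/
theorem theorem2 (d : ℕ) (hd : 0 < d) (μ₁ μ₂ rμ : ℝ) (hμ₁ : 0 < μ₁) (hμ : μ₁ < μ₂)
    (hμ₂ : 1 < μ₂) (hrμ : 0 < rμ) :
    ∃ c₀ : ℝ, 0 < c₀ ∧ ∃ A₀ : ℝ → ℝ → ℝ,
      ∀ α Cα β Cβ γ Cγ cμ : ℝ,
        0 ≤ α → 0 < Cα → 0 < β → β ≤ 1 → 0 < Cβ → 0 < γ → 0 < Cγ → 0 < cμ → cμ ≤ c₀ →
        (α * β < d ∨ (α * β = d ∧ A₀ α Cβ ≤ Cα)) →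
        ∃ c : ℝ, 0 < c ∧ ∀ nP nQ : ℕ, 0 < nP + nQ →
          ENNReal.ofReal (c * ((nP : ℝ) ^ ((2 * β + d) / (2 * γ * β + d)) + (nQ : ℝ)) ^
              (-(β * (1 + α) / (2 * β + d)))) ≤
            PosteriorDrift.minimaxRisk d nP nQ α Cα β Cβ γ Cγ μ₁ μ₂ cμ rμ := by
  obtain ⟨a, ha0, ha1, h1, h2⟩ := PosteriorDrift.exists_tooth_ratio hd hμ hμ₂
  exact ⟨PosteriorDrift.gridRegularity d a (max rμ 1),
    PosteriorDrift.gridRegularity_pos hd ha0 (lt_max_of_lt_left hrμ),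
    fun α Cβ => (Cβ * (1 - a) / 2) ^ (-α),
    fun α Cα β Cβ γ Cγ cμ hα hCα hβ0 hβ1 hCβ hγ hCγ _ hc hαβ =>
      PosteriorDrift.rate_le_minimaxRisk hd ha0 ha1 hα hCα hβ0 hβ1 hCβ hγ hCγ hμ₁ h1 h2 hc hαβ⟩
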